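/- A graph $G=(V,E)$ is a \emph{proper interval graph} if its vertices $v$ can be represented by closed intervals $I_v=[\ell_v,r_v]$, none of which properly contains another, such that two distinct vertices $u,v$ are adjacent if and only if $I_u\cap I_v\neq\emptyset$. For an integer $C\ge 1$, a $[\lambda,C]$-coloring of $G$ is a map $f\colon V\to\{0,\dots,\lambda-1\}$ such that every connected component of every subgraph of $G$ induced by a color class $f^{-1}(i)$ has at most $C$ vertices. The (unweighted) component coloring problem asks, given $G$ and $C$, for a $[\lambda,C]$-coloring of $G$ with the least possible $\lambda$. Theorem. Given a proper interval graph $G=(V,E)$ with an interval representation, the unweighted component coloring problem on $G$ can be solved in $O(|V|)$ time. Precisely: there is a single program for a unit-cost random access machine (with constants, indirect addressing, addition, truncated subtraction and comparison) with the following property. For every $K$ there is a constant $c$ such that, for every $C\ge 1$ and every graph $G$ with vertices $0,\dots,n-1$, the program, given $n$, $C$ and the endpoints $\ell_v,r_v$ (in the order $v=0,\dots,n-1$) of an interval representation of $G$ as above whose endpoints are integers between $0$ and $Kn$, halts after at most $c\,(n+1)$ steps, handles only numbers (memory addresses included) that are at most $c\,(n+C)$, and outputs the least $\lambda$ for which $G$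 has a $[\lambda,C]$-coloring, together with such a coloring. -/

import Mathlib

/-- The closed intervals `[l v, r v]` form an interval representation of `G` in which no interval
properly contains another, i.e. a representation of `G` as a proper interval graph. -/
structure IsProperIntervalRep {V α : Type*} [LinearOrder α] (G : SimpleGraph V)
    (l r : V → α) : Prop where
  le : ∀ v, l v ≤ r v
  adj_iff : ∀ u v, G.Adj u v ↔ u ≠ v ∧ (Set.Icc (l u) (r u) ∩ Set.Icc (l v) (r v)).Nonempty
  proper : ∀ u v, ¬ Set.Icc (l u) (r u) ⊂ Set.Icc (l v) (r v)

/-- `f` is a `[lam, C]`-coloring of `G`: for each of the `lam` colors, every connected component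
of the subgraph induced by the color class has at most `C` vertices. -/
def IsComponentColoring {V : Type*} (G : SimpleGraph V) (lam C : ℕ) (f : V → Fin lam) : Prop :=
  ∀ (i : Fin lam) (K : (G.induce {v | f v = i}).ConnectedComponent), K.supp.encard ≤ C

/-- `f` is a `C`-component coloring of `G`: a `[lam, C]`-coloring with the least possible `lam`. -/
def IsOptimalComponentColoring {V : Type*} (G : SimpleGraph V) (lam C : ℕ) (f : V → Fin lam) :
    Prop :=
  IsComponentColoring G lam C f ∧
    ∀ (mu : ℕ) (g : V → Fin mu), IsComponentColoring G mu C g → lam ≤ mu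

namespace RAM

/-! A random access machine with bounded words, programmed in a structured way.  The memory consists
of variables and arrays holding natural numbers; a program mentions finitely many of them.  The
arithmetic is addition and truncated subtraction.  Every operation costs one time unit, and a run
gets stuck when some number that it handles exceeds the word bound `W`. -/

/-- A memory state. -/
structure State where
  var : ℕ → ℕ
  arr : ℕ → ℕ → ℕ

/-- Store `x` in variable `i`. -/
def State.setVar (s : State) (i x : ℕ) : State :=
  { s with var := Function.update s.var i x }

/-- Store `x` in cell `j` of array `a`. -/
def State.setArr (s : State) (a j x : ℕ) : State :=
  { s with arr := Function.update s.arr a (Function.update (s.arr a) j x) }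

/-- Arithmetic expressions; `get a e` is the content of the cell of array `a` with address `e`. -/
inductive Expr where
  | const (k : ℕ)
  | var (i : ℕ)
  | get (a : ℕ) (e : Expr)
  | add (e₁ e₂ : Expr)
  | sub (e₁ e₂ : Expr)

/-- The value of an expression. -/
def Expr.val (s : State) : Expr → ℕ
  | .const k => k
  | .var i => s.var i
  | .get a e => s.arr a (e.val s)
  | .add e₁ e₂ => e₁.val s + e₂.val s
  | .sub e₁ e₂ => e₁.val s - e₂.val s

/-- All numbers that occur in the evaluation of the expression are at most `W`. -/
def Expr.Fits (W : ℕ) (s : State) : Expr → Prop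
  | .const k => k ≤ W
  | .var i => s.var i ≤ W
  | .get a e => e.Fits W s ∧ s.arr a (e.val s) ≤ W
  | .add e₁ e₂ => e₁.Fits W s ∧ e₂.Fits W s ∧ e₁.val s + e₂.val s ≤ W
  | .sub e₁ e₂ => e₁.Fits W s ∧ e₂.Fits W s

/-- The number of operations in the evaluation of an expression. -/
def Expr.cost : Expr → ℕ
  | .const _ => 1
  | .var _ => 1
  | .get _ e => e.cost + 1
  | .add e₁ e₂ => e₁.cost + e₂.cost + 1
  | .sub e₁ e₂ => e₁.cost + e₂.cost + 1

/-- Programs; the tests of `ite` and `while` are the comparisons `e₁ < e₂`. -/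
inductive Prog where
  | skip
  | assign (i : ℕ) (e : Expr)
  | store (a : ℕ) (addr e : Expr)
  | seq (p q : Prog)
  | ite (e₁ e₂ : Expr) (p q : Prog)
  | while (e₁ e₂ : Expr) (p : Prog)

/-- `Runs W p s t s'`: started in the state `s`, with word bound `W`, the program `p` halts after
exactly `t` time units in the state `s'`. -/
inductive Runs (W : ℕ) : Prog → State → ℕ → State → Prop
  | skip (s : State) : Runs W .skip s 1 s
  | assign (i : ℕ) (e : Expr) (s : State) (he : e.Fits W s) :
      Runs W (.assign i e) s (e.cost + 1) (s.setVar i (e.val s))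
  | store (a : ℕ) (addr e : Expr) (s : State) (ha : addr.Fits W s) (he : e.Fits W s) :
      Runs W (.store a addr e) s (addr.cost + e.cost + 1)
        (s.setArr a (addr.val s) (e.val s))
  | seq (p q : Prog) (s s' s'' : State) (t t' : ℕ) (hp : Runs W p s t s')
      (hq : Runs W q s' t' s'') : Runs W (.seq p q) s (t + t') s''
  | ite_true (e₁ e₂ : Expr) (p q : Prog) (s s' : State) (t : ℕ) (h₁ : e₁.Fits W s)
      (h₂ : e₂.Fits W s) (h : e₁.val s < e₂.val s) (hp : Runs W p s t s') :
      Runs W (.ite e₁ e₂ p q) s (e₁.cost + e₂.cost + 1 + t) s'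
  | ite_false (e₁ e₂ : Expr) (p q : Prog) (s s' : State) (t : ℕ) (h₁ : e₁.Fits W s)
      (h₂ : e₂.Fits W s) (h : ¬ e₁.val s < e₂.val s) (hq : Runs W q s t s') :
      Runs W (.ite e₁ e₂ p q) s (e₁.cost + e₂.cost + 1 + t) s'
  | while_true (e₁ e₂ : Expr) (p : Prog) (s s' s'' : State) (t t' : ℕ) (h₁ : e₁.Fits W s)
      (h₂ : e₂.Fits W s) (h : e₁.val s < e₂.val s) (hp : Runs W p s t s')
      (hw : Runs W (.while e₁ e₂ p) s' t' s'') :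
      Runs W (.while e₁ e₂ p) s (e₁.cost + e₂.cost + 1 + t + t') s''
  | while_false (e₁ e₂ : Expr) (p : Prog) (s : State) (h₁ : e₁.Fits W s)
      (h₂ : e₂.Fits W s) (h : ¬ e₁.val s < e₂.val s) :
      Runs W (.while e₁ e₂ p) s (e₁.cost + e₂.cost + 1) s

end RAM

/-- The input of the component coloring problem: variables `0` and `1` hold the number `n` of
vertices and the size bound `C`, arrays `0` and `1` hold the left and the right endpoints of the
`n` intervals, and the rest of the memory is `0`. -/
def inputState (n C : ℕ) (l r : Fin n → ℕ) : RAM.State where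
  var i := if i = 0 then n else if i = 1 then C else 0
  arr a j := if h : j < n then (if a = 0 then l ⟨j, h⟩ else if a = 1 then r ⟨j, h⟩ else 0) else 0

/-- The memory `s` contains the number `lam` of colors in variable `2` and the color of each
vertex `v` in cell `v` of array `2`. -/
def IsOutput {n : ℕ} (s : RAM.State) (lam : ℕ) (f : Fin n → Fin lam) : Prop :=
  s.var 2 = lam ∧ ∀ v : Fin n, s.arr 2 (v : ℕ) = (f v : ℕ)

/-! Sort the vertices by left endpoint. Since no interval properly contains another, the right
endpoints are sorted too. Hence the earlier neighbours of position `i` fill the segment from `L i`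
to `i - 1`, `L` is nondecreasing, and every window from `L i` to `i` is a clique
(`IsProperIntervalRep.isArrangement`).

A coloring with `d + 1` colors exists exactly when a blocking with span `d` does. Given a blocking,
color by the block number modulo `d + 1`: block numbers of neighbours differ by at most `d`, so
neighbours of equal color share a block (`IsBlocking.isComponentColoring`). Given a coloring, let `E
u` count the monochromatic components lying entirely before `u`, and let `B v` be the maximum of `E
(v - i * C) + i`. As `i * C + 1` consecutive positions meet at least `i + 1` components, `B v + 1`
components have begun by `v`. Those not finished before `L v` each meet the clique window of `v`, in
distinct colors, so there are at most `d + 1` of them; this bounds the span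
(`IsComponentColoring.exists_isBlocking`).

Let `q` be the largest window size divided by `C`, rounded up. At least `q` colors are needed
(`IsBlocking.window_le`), and `q + 1` suffice with blocks of size exactly `C` (`IsBlocking.of_div`).
It remains to decide whether span `q - 1` is possible. This is a system of difference constraints,
whose least solution is found by admitting positions one at a time and propagating violated
constraints. The time is linear because of `IsBlocking.exists_le`: if a blocking exists, some
blocking exceeds the initial value of a new position by at most one. Each value is therefore raised
at most once, and any further demand proves that no blocking exists. Counting sort, division by
repeated addition and a table of remainders supply the rest. -/

/-! ### Blockings, and the colorings they induce -/

/-- `B` numbers the positions `0, …, n - 1` by consecutive blocks of at most `C` positions such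
that no position `i` is more than `d` blocks after the position `L i`. -/
structure IsBlocking (n C d : ℕ) (L B : ℕ → ℕ) : Prop where
  mono : ∀ i, i + 1 < n → B i ≤ B (i + 1)
  size : ∀ i, i + C < n → B i + 1 ≤ B (i + C)
  span : ∀ i, i < n → B i ≤ B (L i) + d

/-- The vertices of `G` are arranged in the order `pos`, in which the neighbours of the vertex at
position `i` that precede it are those at the positions `L i, …, i - 1`. -/
structure IsArrangement {V : Type*} (G : SimpleGraph V) (n : ℕ) (pos : V → ℕ) (L : ℕ → ℕ) :
    Prop where
  inj : Function.Injective pos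
  lt : ∀ v, pos v < n
  surj : ∀ i < n, ∃ v, pos v = i
  le : ∀ i < n, L i ≤ i
  mono : ∀ i j, i ≤ j → j < n → L i ≤ L j
  adj : ∀ u v, pos u < pos v → (G.Adj u v ↔ L (pos v) ≤ pos u)

namespace IsBlocking

variable {n C d : ℕ} {L B : ℕ → ℕ}

theorem le_of_le (h : IsBlocking n C d L B) {i j : ℕ} (hij : i ≤ j) (hj : j < n) : B i ≤ B j := by
  induction j, hij using Nat.le_induction with
  | base => exact le_rfl
  | succ k _ ih => exact (ih (by omega)).trans (h.mono k hj)

theorem add_le (h : IsBlocking n C d L B) (i k : ℕ) (hk : i + k * C < n) :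
    B i + k ≤ B (i + k * C) := by
  induction k with
  | zero => simp
  | succ k ih =>
    have e : i + (k + 1) * C = i + k * C + C := by ring
    rw [e] at hk ⊢
    have := h.size _ hk
    have := ih (by omega)
    omega

/-- A longer window would contain `d + 1` jumps of length `C`, each raising `B`, against the span
condition. This is the lower bound on the number of colors. -/
theorem window_le (h : IsBlocking n C d L B) {i : ℕ} (hi : i < n) :
    i + 1 - L i ≤ (d + 1) * C := by
  by_contra! hlt
  have h1 : L i + (d + 1) * C ≤ i := by omega
  have h2 := h.add_le (L i) (d + 1) (by omega)
  have h3 := h.le_of_le h1 hi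
  have h4 := h.span i hi
  omega

/-- Moving by `d * C` positions changes the quotient by exactly `d`. Together with `window_le` this
leaves only two candidates for the optimum. -/
theorem of_div (hC : 0 < C) (hL : ∀ i < n, i + 1 - L i ≤ d * C) :
    IsBlocking n C d L (fun i => i / C) where
  mono i _ := Nat.div_le_div_right (Nat.le_succ i)
  size i _ := by simp [Nat.add_div_right _ hC]
  span i hi := by
    have h := hL i hi
    calc i / C ≤ (L i + d * C) / C := Nat.div_le_div_right (by omega)
      _ = L i / C + d := Nat.add_mul_div_right _ _ hC

theorem isComponentColoring {V : Type*} {G : SimpleGraph V} {pos : V → ℕ} {lam : ℕ}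
    (h : IsBlocking n C d L B) (hG : IsArrangement G n pos L) (hlam : lam = d + 1)
    (f : V → Fin lam) (hf : ∀ v, (f v : ℕ) = B (pos v) % lam) : IsComponentColoring G lam C f := by
  subst hlam
  have key : ∀ u v, pos u < pos v → G.Adj u v → f u = f v → B (pos u) = B (pos v) := by
    intro u v huv hadj hfe
    have h1 := (hG.adj u v huv).1 hadj
    have h2 := h.span _ (hG.lt v)
    have h3 := h.le_of_le h1 (hG.lt u)
    have h4 := h.le_of_le huv.le (hG.lt v)
    -- Equal colors make the difference of block numbers divisible by `d + 1`, while adjacency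
    -- bounds it by `d`.
    have h5 : B (pos u) ≡ B (pos v) [MOD d + 1] := by
      have := congrArg Fin.val hfe
      rwa [hf, hf] at this
    have h6 := (Nat.modEq_iff_dvd' h4).1 h5
    have h7 := Nat.eq_zero_of_dvd_of_lt h6 (by omega)
    omega
  intro i K
  obtain ⟨v₀, hv₀⟩ := K.nonempty_supp
  have hconst : ∀ w ∈ K.supp, B (pos w) = B (pos v₀) := by
    intro w hw
    have hr : (G.induce {v | f v = i}).Reachable w v₀ :=
      SimpleGraph.ConnectedComponent.exact (hw.trans hv₀.symm)
    obtain ⟨p⟩ := hr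
    clear hv₀ hw
    induction p with
    | nil => rfl
    | @cons a b c hab _ ih =>
      refine Eq.trans ?_ ih
      have hadj : G.Adj a b := hab
      have hfe : f a = f b := a.2.trans b.2.symm
      rcases lt_trichotomy (pos a) (pos b) with hlt | heq | hgt
      · exact key _ _ hlt hadj hfe
      · rw [heq]
      · exact (key _ _ hgt hadj.symm hfe.symm).symm
  classical
  have hex : ∃ j, j < n ∧ B j = B (pos v₀) := ⟨_, hG.lt _, rfl⟩
  -- The first position of the block: by `size`, the block ends before `a + C`.
  set a := Nat.find hex with ha
  obtain ⟨ha1, ha2⟩ := Nat.find_spec hex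
  have hmap : Set.MapsTo (fun w : {v | f v = i} => pos w) K.supp
      (Finset.Ico a (a + C) : Finset ℕ) := by
    intro w hw
    have hB := hconst w hw
    have h1 : a ≤ pos w := Nat.find_min' hex ⟨hG.lt _, hB⟩
    have h2 : pos w < a + C := by
      by_contra! hge
      have h3 := h.le_of_le hge (hG.lt w)
      have h4 := h.size a (lt_of_le_of_lt hge (hG.lt w))
      rw [← ha] at ha2
      omega
    simpa using ⟨h1, h2⟩
  refine (Set.encard_le_encard_of_injOn hmap ?_).trans ?_
  · intro x _ y _ hxy
    exact Subtype.ext (hG.inj hxy)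
  · rw [Set.encard_coe_eq_coe_finsetCard]
    simp

end IsBlocking

/-! ### From colorings to blockings -/

/-- The edges of `G` between vertices of the same color. -/
def monochromatic {V α : Type*} (G : SimpleGraph V) (f : V → α) : SimpleGraph V where
  Adj u v := G.Adj u v ∧ f u = f v
  symm := ⟨fun _ _ h => ⟨h.1.symm, h.2.symm⟩⟩
  loopless := ⟨fun _ h => G.loopless.irrefl _ h.1⟩

/-- A monochromatic path never leaves its color class, so one graph on all of `V` can replace the
family of induced subgraphs, and components of all colors can be counted together. -/
theorem IsComponentColoring.encard_supp_le {V : Type*} {G : SimpleGraph V} {lam C : ℕ}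
    {f : V → Fin lam} (hf : IsComponentColoring G lam C f)
    (c : (monochromatic G f).ConnectedComponent) : c.supp.encard ≤ C := by
  obtain ⟨v, rfl⟩ := c.exists_rep
  let v' : {w | f w = f v} := ⟨v, rfl⟩
  have hsub : ∀ w x, (monochromatic G f).Reachable w x → ∀ hx : f x = f v,
      ∃ hw : f w = f v, (G.induce {w | f w = f v}).Reachable ⟨w, hw⟩ ⟨x, hx⟩ := by
    rintro w x ⟨p⟩
    induction p with
    | nil => exact fun hx => ⟨hx, SimpleGraph.Reachable.refl _⟩
    | cons hab _ ih =>
      intro hx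
      obtain ⟨hb, hr⟩ := ih hx
      refine ⟨hab.2.trans hb, SimpleGraph.Reachable.trans (SimpleGraph.Adj.reachable ?_) hr⟩
      exact hab.1
  refine le_trans ?_ (hf (f v) ((G.induce {w | f w = f v}).connectedComponentMk v'))
  rw [← Subtype.val_injective.encard_image]
  refine Set.encard_le_encard fun w hw => ?_
  obtain ⟨hw', hr⟩ := hsub w v (SimpleGraph.ConnectedComponent.exact hw) rfl
  exact ⟨⟨w, hw'⟩, SimpleGraph.ConnectedComponent.sound hr, rfl⟩

section Blocks

/-- From a function `E` that counts the finished components, the least block numbering above it. -/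
def blockIndex (C : ℕ) (E : ℕ → ℕ) (v : ℕ) : ℕ :=
  (Finset.range (v + 1)).sup fun i => if i * C ≤ v then E (v - i * C) + i else 0

variable {C : ℕ} {E : ℕ → ℕ}

theorem le_blockIndex (hC : 0 < C) (u i : ℕ) : E u + i ≤ blockIndex C E (u + i * C) := by
  have hi : i ≤ i * C := Nat.le_mul_of_pos_right _ hC
  have hle := Finset.le_sup (f := fun j => if j * C ≤ u + i * C then E (u + i * C - j * C) + j else 0)
    (Finset.mem_range.2 (show i < u + i * C + 1 by omega))
  unfold blockIndex
  simpa using hle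

theorem exists_blockIndex_eq (C : ℕ) (E : ℕ → ℕ) (v : ℕ) :
    ∃ u i, v = u + i * C ∧ blockIndex C E v = E u + i := by
  obtain ⟨i, -, hi⟩ := Finset.exists_mem_eq_sup (Finset.range (v + 1)) ⟨0, by simp⟩
    fun i => if i * C ≤ v then E (v - i * C) + i else 0
  by_cases hiv : i * C ≤ v
  · rw [if_pos hiv] at hi
    exact ⟨v - i * C, i, by omega, hi⟩
  -- If the default value `0` attains the maximum, then `E v = 0`, and the term `i = 0` attains it
  -- as well.
  · rw [if_neg hiv] at hi
    have h0 := Finset.le_sup (f := fun i => if i * C ≤ v then E (v - i * C) + i else 0)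
      (Finset.mem_range.2 (Nat.succ_pos v))
    simp only [zero_mul, Nat.zero_le, if_true, Nat.sub_zero, add_zero] at h0
    refine ⟨v, 0, by simp, ?_⟩
    have : blockIndex C E v = 0 := hi
    have : E v ≤ blockIndex C E v := h0
    omega

end Blocks

theorem IsComponentColoring.exists_isBlocking {V : Type*} [Finite V] {G : SimpleGraph V}
    {n C d : ℕ} {pos : V → ℕ} {L : ℕ → ℕ} {f : V → Fin (d + 1)} (hC : 0 < C)
    (hf : IsComponentColoring G (d + 1) C f) (hG : IsArrangement G n pos L) :
    ∃ B, IsBlocking n C d L B := by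
  classical
  have := Fintype.ofFinite V
  set H := monochromatic G f with hH
  have := Fintype.ofFinite H.ConnectedComponent
  let ended (u : ℕ) : Finset H.ConnectedComponent := {c | ∀ w ∈ c.supp, pos w < u}
  let started (v : ℕ) : Finset H.ConnectedComponent := {c | ∃ w ∈ c.supp, pos w ≤ v}
  have hE : ∀ u u', u ≤ u' → (ended u).card ≤ (ended u').card := fun u u' h =>
    Finset.card_le_card fun c hc => by
      simp only [ended, Finset.mem_filter, Finset.mem_univ, true_and] at hc ⊢
      exact fun w hw => (hc w hw).trans_le h
  -- The `i * C + 1` positions from `u` to `u + i * C` meet at least `i + 1` components, none of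
  -- which has ended before `u`.
  have hcount : ∀ u i, u + i * C < n → (ended u).card + i + 1 ≤ (started (u + i * C)).card := by
    intro u i hn
    let X : Finset V := {w | u ≤ pos w ∧ pos w ≤ u + i * C}
    have hX : X.card = i * C + 1 := by
      have : X.image pos = Finset.Icc u (u + i * C) := by
        ext j
        simp only [X, Finset.mem_image, Finset.mem_filter, Finset.mem_univ, true_and,
          Finset.mem_Icc]
        constructor
        · rintro ⟨w, hw, rfl⟩
          exact hw
        · intro hj
          obtain ⟨w, rfl⟩ := hG.surj j (by omega)
          exact ⟨w, hj, rfl⟩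
      rw [← Finset.card_image_of_injective X hG.inj, this, Nat.card_Icc]
      omega
    have hI : X.card ≤ C * (X.image H.connectedComponentMk).card := by
      refine Finset.card_le_mul_card_image X C fun c _ => ?_
      have h1 := hf.encard_supp_le c
      have h2 : ((X.filter fun x => H.connectedComponentMk x = c : Finset V) : Set V) ⊆ c.supp := by
        intro x hx
        simpa using (Finset.mem_filter.1 hx).2
      have h3 := (Set.encard_le_encard h2).trans h1
      rw [Set.encard_coe_eq_coe_finsetCard] at h3
      exact_mod_cast h3
    have hi : i + 1 ≤ (X.image H.connectedComponentMk).card := by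
      by_contra! hlt
      have := Nat.mul_le_mul_left C (Nat.le_of_lt_succ hlt)
      have := Nat.mul_comm C i
      omega
    have hdisj : Disjoint (ended u) (X.image H.connectedComponentMk) := by
      rw [Finset.disjoint_left]
      intro c hc hc'
      obtain ⟨w, hw, rfl⟩ := Finset.mem_image.1 hc'
      have h1 := (Finset.mem_filter.1 hc).2 w rfl
      have h2 := (Finset.mem_filter.1 hw).2.1
      omega
    have hsub : ended u ∪ X.image H.connectedComponentMk ⊆ started (u + i * C) := by
      intro c hc
      refine Finset.mem_filter.2 ⟨Finset.mem_univ _, ?_⟩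
      rcases Finset.mem_union.1 hc with hc | hc
      · obtain ⟨w, hw⟩ := c.nonempty_supp
        have := (Finset.mem_filter.1 hc).2 w hw
        exact ⟨w, hw, by omega⟩
      · obtain ⟨w, hw, rfl⟩ := Finset.mem_image.1 hc
        exact ⟨w, rfl, (Finset.mem_filter.1 hw).2.2⟩
    have := Finset.card_le_card hsub
    rw [Finset.card_union_of_disjoint hdisj] at this
    omega
  have hspan : ∀ v < n, (started v).card ≤ (ended (L v)).card + (d + 1) := by
    intro v hv
    -- A component cannot jump over the window: an edge from before `L v` to a position after `v`
    -- would contradict the monotonicity of `L`.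
    have hmeet : ∀ c ∈ started v \ ended (L v), ∃ w ∈ c.supp, L v ≤ pos w ∧ pos w ≤ v := by
      intro c hc
      obtain ⟨hc1, hc2⟩ := Finset.mem_sdiff.1 hc
      obtain ⟨a, ha, hav⟩ := (Finset.mem_filter.1 hc1).2
      have hc3 : ∃ b ∈ c.supp, L v ≤ pos b := by
        by_contra! hcon
        exact hc2 (Finset.mem_filter.2 ⟨Finset.mem_univ _, hcon⟩)
      obtain ⟨b, hb, hbv⟩ := hc3
      by_contra! hcon
      have ha' : pos a < L v := by
        by_contra! h
        exact absurd (hcon a ha h) (by omega)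
      obtain ⟨p⟩ : H.Reachable a b := SimpleGraph.ConnectedComponent.exact (ha.trans hb.symm)
      obtain ⟨e, he, h1, h2⟩ := p.exists_boundary_dart {w | pos w < L v} ha' (by simpa using hbv)
      have h2' : L v ≤ pos e.snd := by simpa using h2
      have h1' : pos e.fst < L v := h1
      have hmem : e.snd ∈ c.supp := by
        have hr : H.Reachable a e.snd :=
          ⟨p.takeUntil _ (p.dart_snd_mem_support_of_mem_darts he)⟩
        exact (SimpleGraph.ConnectedComponent.sound hr).symm.trans ha
      have h3 := hcon _ hmem h2'
      have h4 := (hG.adj e.fst e.snd (by omega)).1 e.adj.1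
      have h5 := hG.mono v (pos e.snd) h3.le (hG.lt _)
      omega
    have hcard : (started v \ ended (L v)).card ≤ d + 1 := by
      have : Nonempty V := ⟨(hG.surj v hv).choose⟩
      choose! g hg1 hg2 using hmeet
      rw [← Fintype.card_fin (d + 1), ← Finset.card_univ]
      refine Finset.card_le_card_of_injOn (fun c => f (g c)) (fun _ _ => Finset.mem_univ _) ?_
      -- The window is a clique, so two of its vertices with the same color lie in one component;
      -- color is thus injective on the components that meet it.
      have key : ∀ a b, L v ≤ pos a → pos b ≤ v → pos a < pos b → f a = f b →
          H.connectedComponentMk a = H.connectedComponentMk b := by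
        intro a b h1 h2 h3 h4
        refine SimpleGraph.ConnectedComponent.sound (SimpleGraph.Adj.reachable ⟨?_, h4⟩)
        exact (hG.adj a b h3).2 ((hG.mono _ _ h2 hv).trans h1)
      intro c hc c' hc' hcc
      rw [← show H.connectedComponentMk (g c) = c from hg1 c hc,
        ← show H.connectedComponentMk (g c') = c' from hg1 c' hc']
      rcases lt_trichotomy (pos (g c)) (pos (g c')) with hlt | heq | hgt
      · exact key _ _ (hg2 c hc).1 (hg2 c' hc').2 hlt hcc
      · rw [hG.inj heq]
      · exact (key _ _ (hg2 c' hc').1 (hg2 c hc).2 hgt hcc.symm).symm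
    have := Finset.le_card_sdiff (ended (L v)) (started v)
    omega
  have hstep : ∀ v, v < n → blockIndex C (fun u => (ended u).card) v + 1 ≤ (started v).card := by
    intro v hv
    obtain ⟨u, i, rfl, h⟩ := exists_blockIndex_eq C (fun u => (ended u).card) v
    have := hcount u i hv
    omega
  refine ⟨blockIndex C fun u => (ended u).card, ?_, ?_, ?_⟩
  · intro v _
    obtain ⟨u, i, rfl, h⟩ := exists_blockIndex_eq C (fun u => (ended u).card) v
    have h1 := le_blockIndex (E := fun u => (ended u).card) hC (u + 1) i
    have h2 := hE u (u + 1) (by omega)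
    rw [show u + i * C + 1 = u + 1 + i * C by ring]
    omega
  · intro v _
    obtain ⟨u, i, rfl, h⟩ := exists_blockIndex_eq C (fun u => (ended u).card) v
    have h1 := le_blockIndex (E := fun u => (ended u).card) hC u (i + 1)
    rw [show u + i * C + C = u + (i + 1) * C by ring]
    omega
  · intro v hv
    have h1 := hstep v hv
    have h2 := hspan v hv
    have h3 := le_blockIndex (E := fun u => (ended u).card) hC (L v) 0
    simp only [zero_mul, add_zero] at h3
    omega

/-! ### The vertex order by left endpoints -/

section Rank

variable {n : ℕ}

/-- The position of `v` in the stable order by the values of `l`. -/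
def stableRank (l : Fin n → ℕ) (v : Fin n) : ℕ :=
  (Finset.univ.filter fun w => l w < l v).card + (Finset.univ.filter fun w => w < v ∧ l w = l v).card

theorem stableRank_lt (l : Fin n → ℕ) {u v : Fin n} (h : l u < l v ∨ l u = l v ∧ u < v) :
    stableRank l u < stableRank l v := by
  unfold stableRank
  rcases h with h | ⟨h, huv⟩
  · refine Nat.lt_of_lt_of_le ?_ (Nat.le_add_right _ _)
    rw [← Finset.card_union_of_disjoint]
    · refine Finset.card_lt_card (Finset.ssubset_iff_of_subset ?_ |>.2 ⟨u, ?_, ?_⟩)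
      · intro w hw
        simp only [Finset.mem_union, Finset.mem_filter, Finset.mem_univ, true_and] at hw ⊢
        omega
      · simpa using h
      · simp
    · rw [Finset.disjoint_filter]
      omega
  · rw [h]
    refine Nat.add_lt_add_left (Finset.card_lt_card
      (Finset.ssubset_iff_of_subset ?_ |>.2 ⟨u, ?_, ?_⟩)) _
    · intro w hw
      simp only [Finset.mem_filter, Finset.mem_univ, true_and] at hw ⊢
      exact ⟨hw.1.trans huv, hw.2⟩
    · simp [huv, h]
    · simp

theorem stableRank_lt_card (l : Fin n → ℕ) (v : Fin n) : stableRank l v < n := by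
  unfold stableRank
  rw [← Finset.card_union_of_disjoint]
  · have : ((Finset.univ.filter fun w => l w < l v) ∪
        Finset.univ.filter fun w => w < v ∧ l w = l v).card < (Finset.univ : Finset (Fin n)).card :=
      Finset.card_lt_card (Finset.ssubset_iff_of_subset (Finset.subset_univ _) |>.2
        ⟨v, by simp, by simp⟩)
    simpa using this
  · rw [Finset.disjoint_filter]
    omega

theorem stableRank_injective (l : Fin n → ℕ) : Function.Injective (stableRank l) := by
  intro u v huv
  by_contra hne
  rcases lt_trichotomy (l u) (l v) with h | h | h
  · exact absurd huv (stableRank_lt l (Or.inl h)).ne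
  · rcases lt_or_gt_of_ne hne with h' | h'
    · exact absurd huv (stableRank_lt l (Or.inr ⟨h, h'⟩)).ne
    · exact absurd huv (stableRank_lt l (Or.inr ⟨h.symm, h'⟩)).ne'
  · exact absurd huv (stableRank_lt l (Or.inl h)).ne'

theorem le_of_stableRank_le (l : Fin n → ℕ) {u v : Fin n} (h : stableRank l u ≤ stableRank l v) :
    l u ≤ l v := by
  by_contra! hlt
  exact absurd (stableRank_lt l (Or.inl hlt)) (by omega)

theorem exists_stableRank_eq (l : Fin n → ℕ) {i : ℕ} (hi : i < n) : ∃ v, stableRank l v = i := by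
  have hinj : Function.Injective fun v => (⟨stableRank l v, stableRank_lt_card l v⟩ : Fin n) :=
    fun u v h => stableRank_injective l (congrArg Fin.val h)
  obtain ⟨v, hv⟩ := (Finite.injective_iff_surjective.1 hinj) ⟨i, hi⟩
  exact ⟨v, congrArg Fin.val hv⟩

theorem IsProperIntervalRep.right_le {V : Type*} {G : SimpleGraph V} {l r : V → ℕ}
    (h : IsProperIntervalRep G l r) {u v : V} (huv : l u ≤ l v) : r u ≤ r v := by
  by_contra! hlt
  refine h.proper v u ⟨Set.Icc_subset_Icc huv hlt.le, fun hsub => ?_⟩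
  exact absurd (hsub ⟨h.le u, le_rfl⟩).2 (by omega)

/-- Right endpoints increase with rank, so the intervals ending before `l v` occupy an initial
segment of the positions; its length is therefore the first position whose interval reaches `l v`.
-/
theorem IsProperIntervalRep.isArrangement {G : SimpleGraph (Fin n)} {l r : Fin n → ℕ}
    (h : IsProperIntervalRep G l r) {L : ℕ → ℕ}
    (hL : ∀ v, L (stableRank l v) = (Finset.univ.filter fun w => r w < l v).card) :
    IsArrangement G n (stableRank l) L := by
  have hlt : ∀ u v, stableRank l u < L (stableRank l v) ↔ r u < l v := by
    intro u v
    let S : Finset ℕ := (Finset.univ.filter fun w => r w < l v).image (stableRank l)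
    have hS : S.card = L (stableRank l v) := by
      rw [Finset.card_image_of_injective _ (stableRank_injective l), hL]
    have hdown : ∀ i ∈ S, ∀ j ≤ i, j ∈ S := by
      intro i hi j hj
      obtain ⟨w, hw, rfl⟩ := Finset.mem_image.1 hi
      obtain ⟨x, rfl⟩ := exists_stableRank_eq l (hj.trans_lt (stableRank_lt_card l w))
      refine Finset.mem_image_of_mem _ ?_
      have h1 := h.right_le (le_of_stableRank_le l hj)
      simp only [Finset.mem_filter, Finset.mem_univ, true_and] at hw ⊢
      omega
    have hmem : ∀ i, i ∈ S ↔ i < S.card := by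
      intro i
      constructor
      · intro hi
        have : Finset.range (i + 1) ⊆ S := fun j hj =>
          hdown i hi j (Nat.le_of_lt_succ (Finset.mem_range.1 hj))
        simpa using Finset.card_le_card this
      · intro hi
        by_contra hni
        have : S ⊆ Finset.range i := fun j hj => by
          rw [Finset.mem_range]
          by_contra! hij
          exact hni (hdown j hj i hij)
        have := Finset.card_le_card this
        simp only [Finset.card_range] at this
        omega
    rw [← hS, ← hmem]
    constructor
    · intro hu
      obtain ⟨w, hw, hwu⟩ := Finset.mem_image.1 hu
      rw [← stableRank_injective l hwu]
      simpa using hw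
    · intro hu
      exact Finset.mem_image_of_mem _ (by simpa using hu)
  refine ⟨stableRank_injective l, stableRank_lt_card l, fun i hi => exists_stableRank_eq l hi,
    fun i hi => ?_, fun i j hij hj => ?_, fun u v huv => ?_⟩
  · obtain ⟨v, rfl⟩ := exists_stableRank_eq l hi
    by_contra! hcon
    have := (hlt v v).1 hcon
    have := h.le v
    omega
  · obtain ⟨v, rfl⟩ := exists_stableRank_eq l hj
    obtain ⟨u, rfl⟩ := exists_stableRank_eq l (hij.trans_lt hj)
    rw [hL, hL]
    have := le_of_stableRank_le l hij
    refine Finset.card_le_card fun w hw => ?_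
    simp only [Finset.mem_filter, Finset.mem_univ, true_and] at hw ⊢
    omega
  · have hluv := le_of_stableRank_le l huv.le
    rw [h.adj_iff, ← not_lt, hlt, not_lt]
    constructor
    · rintro ⟨-, x, hx1, hx2⟩
      exact hx2.1.trans hx1.2
    · intro hv
      refine ⟨?_, l v, ⟨hluv, hv⟩, le_rfl, h.le v⟩
      rintro rfl
      exact lt_irrefl _ huv

end Rank

/-! ### Reasoning about programs: loop-free code, frames and loops -/

namespace RAM

/-- The effect of a program without loops. -/
def Prog.exec : Prog → State → State
  | .skip, s => s
  | .assign i e, s => s.setVar i (e.val s)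
  | .store a addr e, s => s.setArr a (addr.val s) (e.val s)
  | .seq p q, s => q.exec (p.exec s)
  | .ite e₁ e₂ p q, s => if e₁.val s < e₂.val s then p.exec s else q.exec s
  | .while _ _ _, s => s

/-- The program contains no loop, and started in `s` it handles only numbers up to `W`. -/
def Prog.Safe (W : ℕ) : Prog → State → Prop
  | .skip, _ => True
  | .assign _ e, s => e.Fits W s
  | .store _ addr e, s => addr.Fits W s ∧ e.Fits W s
  | .seq p q, s => p.Safe W s ∧ q.Safe W (p.exec s)
  | .ite e₁ e₂ p q, s => e₁.Fits W s ∧ e₂.Fits W s ∧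
      (e₁.val s < e₂.val s → p.Safe W s) ∧ (¬ e₁.val s < e₂.val s → q.Safe W s)
  | .while _ _ _, _ => False

/-- A bound on the running time of a program without loops. -/
def Prog.time : Prog → ℕ
  | .skip => 1
  | .assign _ e => e.cost + 1
  | .store _ addr e => addr.cost + e.cost + 1
  | .seq p q => p.time + q.time
  | .ite e₁ e₂ p q => e₁.cost + e₂.cost + 1 + (p.time + q.time)
  | .while _ _ _ => 0

/-- The variables to which a program assigns. -/
def Prog.vars : Prog → List ℕ
  | .skip => []
  | .assign i _ => [i]
  | .store _ _ _ => []
  | .seq p q => p.vars ++ q.vars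
  | .ite _ _ p q => p.vars ++ q.vars
  | .while _ _ p => p.vars

/-- The arrays into which a program stores. -/
def Prog.arrs : Prog → List ℕ
  | .skip => []
  | .assign _ _ => []
  | .store a _ _ => [a]
  | .seq p q => p.arrs ++ q.arrs
  | .ite _ _ p q => p.arrs ++ q.arrs
  | .while _ _ p => p.arrs

/-- The states agree on everything that `p` does not write. -/
def Prog.Frame (p : Prog) (s s' : State) : Prop :=
  (∀ i, i ∉ p.vars → s'.var i = s.var i) ∧ ∀ a, a ∉ p.arrs → s'.arr a = s.arr a

theorem Prog.Frame.refl (p : Prog) (s : State) : p.Frame s s := ⟨fun _ _ => rfl, fun _ _ => rfl⟩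

theorem Prog.Frame.trans {p : Prog} {s s' s'' : State} (h : p.Frame s s') (h' : p.Frame s' s'') :
    p.Frame s s'' :=
  ⟨fun i hi => (h'.1 i hi).trans (h.1 i hi), fun a ha => (h'.2 a ha).trans (h.2 a ha)⟩

theorem Prog.frame_exec (p : Prog) (s : State) : p.Frame s (p.exec s) := by
  induction p generalizing s with
  | skip => exact .refl _ _
  | assign i e =>
    refine ⟨fun j hj => ?_, fun _ _ => rfl⟩
    exact Function.update_of_ne (by simpa [Prog.vars] using hj) _ _
  | store a addr e =>
    refine ⟨fun _ _ => rfl, fun j hj => ?_⟩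
    exact Function.update_of_ne (by simpa [Prog.arrs] using hj) _ _
  | seq p q ihp ihq =>
    constructor
    · intro i hi
      simp only [Prog.vars, List.mem_append, not_or] at hi
      exact ((ihq _).1 i hi.2).trans ((ihp _).1 i hi.1)
    · intro i hi
      simp only [Prog.arrs, List.mem_append, not_or] at hi
      exact ((ihq _).2 i hi.2).trans ((ihp _).2 i hi.1)
  | ite e₁ e₂ p q ihp ihq =>
    constructor
    · intro i hi
      simp only [Prog.vars, List.mem_append, not_or] at hi
      unfold Prog.exec
      split_ifs
      · exact (ihp _).1 i hi.1
      · exact (ihq _).1 i hi.2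
    · intro i hi
      simp only [Prog.arrs, List.mem_append, not_or] at hi
      unfold Prog.exec
      split_ifs
      · exact (ihp _).2 i hi.1
      · exact (ihq _).2 i hi.2
  | _ => exact .refl _ _

theorem Prog.Safe.runs {W : ℕ} {p : Prog} {s : State} (h : p.Safe W s) :
    ∃ t, Runs W p s t (p.exec s) ∧ t ≤ p.time := by
  induction p generalizing s with
  | skip => exact ⟨_, .skip s, le_rfl⟩
  | assign i e => exact ⟨_, .assign i e s h, le_rfl⟩
  | store a addr e => exact ⟨_, .store a addr e s h.1 h.2, le_rfl⟩
  | seq p q ihp ihq =>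
    obtain ⟨t, hp, ht⟩ := ihp h.1
    obtain ⟨t', hq, ht'⟩ := ihq h.2
    exact ⟨_, .seq _ _ _ _ _ _ _ hp hq, Nat.add_le_add ht ht'⟩
  | ite e₁ e₂ p q ihp ihq =>
    obtain ⟨h₁, h₂, hp, hq⟩ := h
    unfold Prog.exec Prog.time
    split_ifs with hlt
    · obtain ⟨t, hr, ht⟩ := ihp (hp hlt)
      exact ⟨_, .ite_true _ _ _ _ _ _ _ h₁ h₂ hlt hr, by omega⟩
    · obtain ⟨t, hr, ht⟩ := ihq (hq hlt)
      exact ⟨_, .ite_false _ _ _ _ _ _ _ h₁ h₂ hlt hr, by omega⟩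
  | _ => exact h.elim

/-- Started in `s`, the program halts within `T` steps, changes nothing but what it writes, and
reaches a state with the property `Q`. -/
def Prog.Reaches (W : ℕ) (p : Prog) (s : State) (T : ℕ) (Q : State → Prop) : Prop :=
  ∃ t s', Runs W p s t s' ∧ t ≤ T ∧ p.Frame s s' ∧ Q s'

theorem Prog.Reaches.mono_time {W : ℕ} {p : Prog} {s : State} {T T' : ℕ} {Q : State → Prop}
    (h : p.Reaches W s T Q) (hT : T ≤ T') : p.Reaches W s T' Q := by
  obtain ⟨t, s', hr, ht, hf, hQ⟩ := h
  exact ⟨t, s', hr, ht.trans hT, hf, hQ⟩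

theorem Prog.reaches_of_safe {W : ℕ} {p : Prog} {s : State} {T : ℕ} {Q : State → Prop}
    (h : p.Safe W s) (hT : p.time ≤ T) (hQ : Q (p.exec s)) : p.Reaches W s T Q := by
  obtain ⟨t, hr, ht⟩ := h.runs
  exact ⟨t, _, hr, ht.trans hT, p.frame_exec s, hQ⟩

/-- The potential bounds the number of passes, and a loop-free body has a bounded cost. The frame is
passed to every step so that invariants need not mention memory that the loop leaves alone. -/
theorem Prog.reaches_while {W : ℕ} {e₁ e₂ : Expr} {p : Prog} {s : State} {T : ℕ}
    {Q : State → Prop} (I : State → Prop) (Φ : State → ℕ) (h0 : I s)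
    (hstep : ∀ s', p.Frame s s' → I s' → e₁.Fits W s' ∧ e₂.Fits W s' ∧
      (e₁.val s' < e₂.val s' → p.Safe W s' ∧ I (p.exec s') ∧ Φ (p.exec s') < Φ s'))
    (hT : (Φ s + 1) * (e₁.cost + e₂.cost + 1 + p.time) ≤ T)
    (hQ : ∀ s', p.Frame s s' → I s' → ¬ e₁.val s' < e₂.val s' → Q s') :
    (Prog.while e₁ e₂ p).Reaches W s T Q := by
  have key : ∀ k s', p.Frame s s' → I s' → Φ s' = k → ∃ t s'', Runs W (.while e₁ e₂ p) s' t s'' ∧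
      t ≤ (k + 1) * (e₁.cost + e₂.cost + 1 + p.time) ∧ p.Frame s s'' ∧ I s'' ∧
      ¬ e₁.val s'' < e₂.val s'' := by
    intro k
    induction k using Nat.strong_induction_on with
    | _ k ih =>
      intro s' hf hI hk
      obtain ⟨h₁, h₂, hb⟩ := hstep s' hf hI
      by_cases hlt : e₁.val s' < e₂.val s'
      · obtain ⟨hsafe, hI', hΦ⟩ := hb hlt
        obtain ⟨t, hr, ht⟩ := hsafe.runs
        obtain ⟨t', s'', hr', ht', hf', hQ'⟩ :=
          ih _ (hk ▸ hΦ) _ (hf.trans (p.frame_exec s')) hI' rfl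
        refine ⟨_, s'', .while_true _ _ _ _ _ _ _ _ h₁ h₂ hlt hr hr', ?_, hf', hQ'⟩
        have : (Φ (p.exec s') + 1) * (e₁.cost + e₂.cost + 1 + p.time) ≤
            k * (e₁.cost + e₂.cost + 1 + p.time) := Nat.mul_le_mul_right _ (by omega)
        rw [Nat.add_mul k]
        omega
      · refine ⟨_, s', .while_false _ _ _ _ h₁ h₂ hlt, ?_, hf, hI, hlt⟩
        rw [Nat.add_mul]
        omega
  obtain ⟨t, s', hr, ht, hf, hI, hlt⟩ := key _ s (.refl _ _) h0 rfl
  exact ⟨t, s', hr, ht.trans hT, hf, hQ s' hf hI hlt⟩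

end RAM

/-! ### Deciding the existence of a blocking by propagation -/

open RAM

/-- The constraints of a blocking of the first `m` positions that bound the value at another
position from below in terms of the value at `v`. -/
def IsStable (m C d : ℕ) (L b : ℕ → ℕ) (v : ℕ) : Prop :=
  (v + 1 < m → b v ≤ b (v + 1)) ∧ (v + C < m → b v + 1 ≤ b (v + C)) ∧ b v ≤ b (L v) + d

theorem IsStable.isBlocking {m C d : ℕ} {L b : ℕ → ℕ} (h : ∀ v < m, IsStable m C d L b v) :
    IsBlocking m C d L b :=
  ⟨fun i hi => (h i (by omega)).1 hi, fun i hi => (h i (by omega)).2.1 hi,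
    fun i hi => (h i hi).2.2⟩

/-- A blocking can be chosen so that at position `m` it exceeds the least possible extension of a
given lower bound on the positions before `m` at most by one. -/
theorem IsBlocking.exists_le {n m C d x : ℕ} {L b B : ℕ → ℕ} (hB : IsBlocking n C d L B)
    (hC : 0 < C) (hL : ∀ i < n, L i ≤ i) (hb : IsBlocking m C d L b)
    (hx : 0 < m → b (m - 1) ≤ x) : ∃ B', IsBlocking n C d L B' ∧ B' m ≤ x + 1 := by
  by_cases hk : B m ≤ x + 1
  · exact ⟨B, hB, hk⟩
  obtain ⟨k, hk⟩ : ∃ k, B m = x + 1 + k := ⟨B m - (x + 1), by omega⟩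
  have hbx : ∀ v < m, b v ≤ x := fun v hv =>
    (hb.le_of_le (show v ≤ m - 1 by omega) (by omega)).trans (hx (by omega))
  have hBm : ∀ v, m ≤ v → v < n → x + 1 + k ≤ B v := fun v h1 h2 => hk ▸ hB.le_of_le h1 h2
  -- Lowering `B` by `k` gives the value `x + 1` at `m`; before `m` the lower bound `b` is kept. A
  -- constraint from an old to a new position holds because `b` is at most `x` there and new values
  -- are at least `x + 1`. The size constraint consumes this slack of one.
  refine ⟨fun v => if v < m then max (b v) (B v - k) else B v - k, ⟨?_, ?_, ?_⟩, ?_⟩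
  · intro i hi
    have h1 := hB.mono i hi
    split_ifs with h2 h3
    · have := hb.mono i h3
      omega
    · have := hbx i h2
      have := hBm (i + 1) (by omega) hi
      omega
    · omega
    · omega
  · intro i hi
    have h1 := hB.size i hi
    split_ifs with h2 h3
    · have := hb.size i h3
      omega
    · have := hbx i h2
      have := hBm (i + C) (by omega) hi
      omega
    · omega
    · have := hBm i (by omega) (by omega)
      omega
  · intro i hi
    have h1 := hB.span i hi
    have h2 := hL i hi
    split_ifs with h3 h4 h5
    · have := hb.span i h3
      omega
    · omega
    · omega
    · omega
  · simp only [lt_self_iff_false, if_false]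
    omega

/-- The number of positions that have not been raised. -/
def unraised (n : ℕ) (a : ℕ → ℕ) : ℕ := ((Finset.range n).filter fun v => a v = 0).card

theorem unraised_update {n w : ℕ} {a : ℕ → ℕ} (hw : w < n) (ha : a w = 0) :
    unraised n (Function.update a w 1) + 1 = unraised n a := by
  unfold unraised
  have : (Finset.range n).filter (fun v => Function.update a w 1 v = 0) =
      ((Finset.range n).filter fun v => a v = 0).erase w := by
    ext v
    simp only [Finset.mem_filter, Finset.mem_erase, Finset.mem_range, Function.update_apply]
    split_ifs with h <;> simp [h]
  rw [this]
  exact Finset.card_erase_add_one (by simp [hw, ha])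

namespace RAM

/-- The potential of the propagation loop: number of positions to come, size of the stack and
number of positions that can still be raised. -/
def propagationPotential (n : ℕ) (s : State) : ℕ :=
  2 * (n - s.var 14) + s.var 15 + unraised n (s.arr 8)

/-- The invariant of the propagation loop.  Array `7` holds the current lower bounds, array `8`
marks the positions that have been raised, array `9` is the stack of positions whose constraints
are to be checked, and variable `16` is set if there is no blocking.  The positions in `ex` are
exempted from the condition that an unchecked position is on the stack. -/
structure PropagationInv (n C d : ℕ) (L : ℕ → ℕ) (ex : ℕ → Prop) (s : State) : Prop where
  var_zero : s.var 0 = n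
  var_one : s.var 1 = C
  var_d : s.var 13 = d
  arr_L : s.arr 6 = L
  m_le : s.var 14 ≤ n
  stack : ∀ j < s.var 15, s.arr 9 j < s.var 14
  raised_le : ∀ v, s.arr 8 v ≤ 1
  raised_zero : ∀ v, s.var 14 ≤ v → s.arr 8 v = 0
  start : s.var 14 = 0 → s.arr 7 0 = 0
  bound : ∀ v < s.var 14, s.arr 7 v ≤ 2 * v + s.arr 8 v
  lower : ∀ B, IsBlocking n C d L B → ∀ v < s.var 14, s.arr 7 v ≤ B v
  upper : ∀ B, IsBlocking n C d L B → ∀ v < s.var 14,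
    ∃ B', IsBlocking n C d L B' ∧ B' v + s.arr 8 v ≤ s.arr 7 v + 1
  closed : s.var 16 = 0 → ∀ v < s.var 14, (∃ j < s.var 15, s.arr 9 j = v) ∨ ex v ∨
    IsStable (s.var 14) C d L (s.arr 7) v
  failed : s.var 16 ≠ 0 → ∀ B, ¬ IsBlocking n C d L B
  flag_le : s.var 16 ≤ 1
  potential : propagationPotential n s ≤ 3 * n

/-- Require the value at the position in variable `18` to be at least variable `19`. -/
def relaxProg : Prog :=
  .ite (.get 7 (.var 18)) (.var 19)
    (.ite (.add (.var 19) (.get 8 (.var 18))) (.add (.get 7 (.var 18)) (.const 2))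
      (.seq (.store 7 (.var 18) (.var 19))
        (.seq (.store 8 (.var 18) (.const 1))
          (.seq (.store 9 (.var 15) (.var 18))
            (.assign 15 (.add (.var 15) (.const 1))))))
      (.assign 16 (.const 1)))
    .skip

/-- What the relaxation of the bound at `w` to `x` guarantees about the states before and after. -/
structure Relaxed (n C d : ℕ) (L : ℕ → ℕ) (ex : ℕ → Prop) (w x : ℕ) (s s' : State) : Prop where
  inv : PropagationInv n C d L ex s'
  pot : propagationPotential n s' ≤ propagationPotential n s
  var_m : s'.var 14 = s.var 14
  var_u : s'.var 17 = s.var 17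
  le : ∀ v, s.arr 7 v ≤ s'.arr 7 v
  eq : ∀ v, v ≠ w ∨ x ≤ s.arr 7 w → s'.arr 7 v = s.arr 7 v
  flag : s'.var 16 = 0 → s.var 16 = 0 ∧ (w < s.var 14 → x ≤ s'.arr 7 w)

/-- The field `upper` leaves room for one unit above the initial value at a position. A demand
beyond this unit refutes every blocking; a demand within it is met by the only raise the position
ever receives. -/
theorem PropagationInv.relax {n C d W : ℕ} {L : ℕ → ℕ} {ex : ℕ → Prop} {s : State}
    (h : PropagationInv n C d L ex s) (hW : 8 * (n + C) + 8 ≤ W)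
    (hw : s.var 18 < s.var 14) (hx : s.var 19 ≤ 2 * n + 2)
    (hB : ∀ B, IsBlocking n C d L B → s.var 19 ≤ B (s.var 18)) :
    relaxProg.Safe W s ∧ Relaxed n C d L ex (s.var 18) (s.var 19) s (relaxProg.exec s) := by
  have hm := h.m_le
  have hb := h.bound _ hw
  have hr := h.raised_le (s.var 18)
  have hpot := h.potential
  have hsp : s.var 15 ≤ 3 * n := by
    unfold propagationPotential at hpot
    omega
  constructor
  · simp only [relaxProg, Prog.Safe, Prog.exec, Expr.Fits, Expr.val, State.setArr]
    simp
    omega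
  by_cases h1 : s.arr 7 (s.var 18) < s.var 19
  swap
  · have : relaxProg.exec s = s := by
      simp [relaxProg, Prog.exec, Expr.val, h1]
    rw [this]
    exact ⟨h, le_rfl, rfl, rfl, fun _ => le_rfl, fun _ _ => rfl, fun h0 => ⟨h0, fun _ => by omega⟩⟩
  -- The test asks whether the demand is at most the current value plus one, minus the unit already
  -- spent.
  by_cases h2 : s.var 19 + s.arr 8 (s.var 18) < s.arr 7 (s.var 18) + 2
  swap
  · have hno : ∀ B, ¬ IsBlocking n C d L B := by
      intro B hB0
      obtain ⟨B', hB', hle⟩ := h.upper B hB0 _ hw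
      have := hB B' hB'
      omega
    have : relaxProg.exec s = s.setVar 16 1 := by
      simp [relaxProg, Prog.exec, Expr.val, h1, h2]
    rw [this]
    refine ⟨?_, le_of_eq rfl, rfl, rfl, fun _ => le_rfl, fun _ _ => rfl, fun h0 => ?_⟩
    · exact ⟨h.var_zero, h.var_one, h.var_d, h.arr_L, h.m_le, h.stack, h.raised_le, h.raised_zero,
        h.start, h.bound, h.lower, h.upper, fun h0 => by simp [State.setVar] at h0,
        fun _ => hno, by simp [State.setVar], h.potential⟩
    · simp [State.setVar] at h0
  have hr0 : s.arr 8 (s.var 18) = 0 := by omega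
  have hx1 : s.var 19 = s.arr 7 (s.var 18) + 1 := by omega
  set s' := relaxProg.exec s with hs'
  have e : s' = ⟨Function.update s.var 15 (s.var 15 + 1), Function.update
      (Function.update (Function.update s.arr 7 (Function.update (s.arr 7) (s.var 18) (s.var 19)))
        8 (Function.update (s.arr 8) (s.var 18) 1))
      9 (Function.update (s.arr 9) (s.var 15) (s.var 18))⟩ := by
    rw [hs']
    simp [relaxProg, Prog.exec, Expr.val, h1, h2, State.setVar, State.setArr]
  have ev : ∀ i, i ≠ 15 → s'.var i = s.var i := fun i hi => by
    rw [e]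
    exact Function.update_of_ne hi _ _
  have e15 : s'.var 15 = s.var 15 + 1 := by simp [e]
  have e6 : s'.arr 6 = s.arr 6 := by simp [e]
  have e7 : s'.arr 7 = Function.update (s.arr 7) (s.var 18) (s.var 19) := by simp [e]
  have e8 : s'.arr 8 = Function.update (s.arr 8) (s.var 18) 1 := by simp [e]
  have e9 : s'.arr 9 = Function.update (s.arr 9) (s.var 15) (s.var 18) := by simp [e]
  have hle : ∀ v, s.arr 7 v ≤ s'.arr 7 v := by
    intro v
    rw [e7, Function.update_apply]
    split_ifs with hv
    · subst hv; omega
    · exact le_rfl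
  have heq : ∀ v, v ≠ s.var 18 → s'.arr 7 v = s.arr 7 v := by
    intro v hv
    rw [e7, Function.update_of_ne hv]
  -- The new stack entry is paid for by the position that ceases to be raisable.
  have hpot' : propagationPotential n s' ≤ propagationPotential n s := by
    unfold propagationPotential
    have := unraised_update (lt_of_lt_of_le hw hm) hr0
    rw [ev 14 (by decide), e15, e8]
    omega
  refine ⟨?_, hpot', ev 14 (by decide), ev 17 (by decide), hle, fun v hv => ?_, fun h0 => ?_⟩
  · constructor
    · rw [ev _ (by decide)]; exact h.var_zero
    · rw [ev _ (by decide)]; exact h.var_one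
    · rw [ev _ (by decide)]; exact h.var_d
    · rw [e6]; exact h.arr_L
    · rw [ev _ (by decide)]; exact h.m_le
    · intro j hj
      rw [ev 14 (by decide), e9, Function.update_apply]
      rw [e15] at hj
      split_ifs with hj'
      · exact hw
      · exact h.stack j (by omega)
    · intro v
      rw [e8, Function.update_apply]
      split_ifs
      · exact le_rfl
      · exact h.raised_le v
    · intro v hv
      rw [ev 14 (by decide)] at hv
      rw [e8, Function.update_of_ne (by omega)]
      exact h.raised_zero v hv
    · intro h0
      rw [ev 14 (by decide)] at h0
      omega
    · intro v hv
      rw [ev 14 (by decide)] at hv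
      have := h.bound v hv
      rw [e7, e8, Function.update_apply, Function.update_apply]
      split_ifs with hv'
      · subst hv'; omega
      · exact this
    · intro B hB0 v hv
      rw [ev 14 (by decide)] at hv
      rw [e7, Function.update_apply]
      split_ifs with hv'
      · subst hv'; exact hB B hB0
      · exact h.lower B hB0 v hv
    · intro B hB0 v hv
      rw [ev 14 (by decide)] at hv
      obtain ⟨B', hB', hle⟩ := h.upper B hB0 v hv
      refine ⟨B', hB', ?_⟩
      rw [e7, e8, Function.update_apply, Function.update_apply]
      split_ifs with hv'
      · subst hv'; omega
      · exact hle
    · intro h0 v hv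
      rw [ev 16 (by decide)] at h0
      rw [ev 14 (by decide)] at hv ⊢
      by_cases hvw : v = s.var 18
      · exact Or.inl ⟨s.var 15, by omega, by rw [e9, hvw]; simp⟩
      rcases h.closed h0 v hv with ⟨j, hj, hjv⟩ | hex | hst
      · exact Or.inl ⟨j, by omega, by rw [e9, Function.update_of_ne (by omega), hjv]⟩
      · exact Or.inr (Or.inl hex)
      -- Raising a value can only break constraints in which it is the smaller side; all others gain
      -- slack.
      · refine Or.inr (Or.inr ⟨fun hv1 => ?_, fun hv1 => ?_, ?_⟩) <;> rw [heq v hvw]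
        · exact (hst.1 hv1).trans (hle _)
        · exact (hst.2.1 hv1).trans (hle _)
        · exact hst.2.2.trans (Nat.add_le_add_right (hle _) _)
    · rw [ev 16 (by decide)]; exact h.failed
    · rw [ev 16 (by decide)]; exact h.flag_le
    · exact hpot'.trans h.potential
  · rcases hv with hv | hv
    · exact heq v hv
    · omega
  · rw [ev 16 (by decide)] at h0
    exact ⟨h0, fun _ => by rw [e7]; simp⟩

theorem PropagationInv.congr {n C d : ℕ} {L : ℕ → ℕ} {ex : ℕ → Prop} {s s' : State}
    (h : PropagationInv n C d L ex s) (ha : s'.arr = s.arr)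
    (hv : ∀ i ∈ [0, 1, 13, 14, 15, 16], s'.var i = s.var i) : PropagationInv n C d L ex s' := by
  simp only [List.forall_mem_cons, List.not_mem_nil, false_imp_iff, implies_true, and_true] at hv
  obtain ⟨v0, v1, v13, v14, v15, v16⟩ := hv
  obtain ⟨a1, a2, a3, a4, a5, a6, a7, a8, a9, a10, a11, a12, a13, a14, a15, a16⟩ := h
  constructor <;> simp only [propagationPotential, ha, v0, v1, v13, v14, v15, v16] <;> assumption

/-- Require the value at the position `e` to be at least `e'` if the position is in use. -/
def edgeProg (e e' : Expr) : Prog :=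
  .seq (.assign 18 e) (.seq (.assign 19 e') (.ite (.var 18) (.var 14) relaxProg .skip))

/-- A target not yet in use may be skipped: its constraints from earlier positions enter its initial
value when it is pushed. -/
theorem PropagationInv.edge {n C d W : ℕ} {L : ℕ → ℕ} {ex : ℕ → Prop} {s : State} {e e' : Expr}
    {w x : ℕ} (h : PropagationInv n C d L ex s) (hW : 8 * (n + C) + 8 ≤ W)
    (he : e.Fits W s) (he' : e'.Fits W (s.setVar 18 w)) (hw : e.val s = w)
    (hx : e'.val (s.setVar 18 w) = x) (hwn : w ≤ 2 * n + C) (hxn : x ≤ 2 * n + 2)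
    (hB : w < s.var 14 → ∀ B, IsBlocking n C d L B → x ≤ B w) :
    (edgeProg e e').Safe W s ∧ Relaxed n C d L ex w x s ((edgeProg e e').exec s) := by
  subst hw
  subst hx
  have hm := h.m_le
  set s₁ := (s.setVar 18 (e.val s)).setVar 19 (e'.val (s.setVar 18 (e.val s))) with hs₁
  have h₁ : PropagationInv n C d L ex s₁ :=
    h.congr rfl (by simp [hs₁, State.setVar])
  have v18 : s₁.var 18 = e.val s := by simp [hs₁, State.setVar]
  have v19 : s₁.var 19 = e'.val (s.setVar 18 (e.val s)) := by simp [hs₁, State.setVar]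
  have v14 : s₁.var 14 = s.var 14 := by simp [hs₁, State.setVar]
  have v15 : s₁.var 15 = s.var 15 := by simp [hs₁, State.setVar]
  have v16 : s₁.var 16 = s.var 16 := by simp [hs₁, State.setVar]
  have v17 : s₁.var 17 = s.var 17 := by simp [hs₁, State.setVar]
  have arr : s₁.arr = s.arr := rfl
  have hpot : propagationPotential n s₁ = propagationPotential n s := by
    simp only [propagationPotential, v14, v15, arr]
  have hexec : (edgeProg e e').exec s =
      if s₁.var 18 < s₁.var 14 then relaxProg.exec s₁ else s₁ := rfl
  have hsafe : (edgeProg e e').Safe W s ↔ e.Fits W s ∧ e'.Fits W (s.setVar 18 (e.val s)) ∧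
      s₁.var 18 ≤ W ∧ s₁.var 14 ≤ W ∧ (s₁.var 18 < s₁.var 14 → relaxProg.Safe W s₁) ∧
      (¬ s₁.var 18 < s₁.var 14 → True) := Iff.rfl
  rw [hexec, hsafe]
  by_cases hlt : s₁.var 18 < s₁.var 14
  · obtain ⟨hs, hr⟩ := h₁.relax hW hlt (by omega) (fun B hB0 => by
      rw [v18, v19]
      exact hB (by omega) B hB0)
    rw [if_pos hlt]
    refine ⟨⟨he, he', by omega, by omega, fun _ => hs, fun _ => trivial⟩, ?_⟩
    obtain ⟨r1, r2, r3, r4, r5, r6, r7⟩ := hr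
    rw [v18, v19] at *
    rw [arr] at *
    exact ⟨r1, by omega, by omega, by omega, r5, r6, by rwa [v16, v14] at r7⟩
  · rw [if_neg hlt]
    refine ⟨⟨he, he', by omega, by omega, fun h => absurd h hlt, fun _ => trivial⟩, ?_⟩
    exact ⟨h₁, hpot.le, v14, v17, fun _ => le_rfl, fun _ _ => rfl,
      fun h0 => ⟨by omega, fun _ => by omega⟩⟩

/-- Take a position from the stack and check its constraints. -/
def popProg : Prog :=
  .seq (.assign 15 (.sub (.var 15) (.const 1)))
    (.seq (.assign 17 (.get 9 (.var 15)))
      (.seq (edgeProg (.add (.var 17) (.const 1)) (.get 7 (.var 17)))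
        (.seq (edgeProg (.add (.var 17) (.var 1)) (.add (.get 7 (.var 17)) (.const 1)))
          (edgeProg (.get 6 (.var 17)) (.sub (.get 7 (.var 17)) (.var 13))))))

/-- The popped position is exempt from `closed` while its constraints are enforced. Its own value
stays fixed meanwhile, so all three constraints hold at the end and the exemption can be dropped. -/
theorem PropagationInv.pop {n C d W : ℕ} {L : ℕ → ℕ} {s : State}
    (h : PropagationInv n C d L (fun _ => False) s) (hW : 8 * (n + C) + 8 ≤ W) (hC : 0 < C)
    (hd : d ≤ n) (hL : ∀ i < n, L i ≤ i) (hsp : 0 < s.var 15) :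
    popProg.Safe W s ∧ PropagationInv n C d L (fun _ => False) (popProg.exec s) ∧
      propagationPotential n (popProg.exec s) < propagationPotential n s := by
  have hm := h.m_le
  have hsp3 : s.var 15 ≤ 3 * n := by
    have := h.potential
    unfold propagationPotential at this
    omega
  obtain ⟨u, hu⟩ : ∃ u, u = s.arr 9 (s.var 15 - 1) := ⟨_, rfl⟩
  have hum : u < s.var 14 := hu ▸ h.stack _ (by omega)
  set s₁ := (s.setVar 15 (s.var 15 - 1)).setVar 17 u with hs₁
  have a₁ : s₁.arr = s.arr := rfl
  have v15 : s₁.var 15 = s.var 15 - 1 := by simp [hs₁, State.setVar]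
  have v17 : s₁.var 17 = u := by simp [hs₁, State.setVar]
  have ev : ∀ i, i ≠ 15 → i ≠ 17 → s₁.var i = s.var i := fun i h1 h2 => by
    simp [hs₁, State.setVar, h1, h2]
  have v14 := ev 14 (by decide) (by decide)
  have v16 := ev 16 (by decide) (by decide)
  have hpot : propagationPotential n s₁ + 1 = propagationPotential n s := by
    simp only [propagationPotential, v14, v15, a₁]
    omega
  have h₁ : PropagationInv n C d L (fun v => v = u) s₁ := by
    refine ⟨(ev 0 (by decide) (by decide)).trans h.var_zero,
      (ev 1 (by decide) (by decide)).trans h.var_one,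
      (ev 13 (by decide) (by decide)).trans h.var_d, h.arr_L, v14 ▸ h.m_le, ?_, h.raised_le,
      v14 ▸ h.raised_zero, v14 ▸ h.start, v14 ▸ h.bound, v14 ▸ h.lower, v14 ▸ h.upper, ?_,
      v16 ▸ h.failed, v16 ▸ h.flag_le, by have := h.potential; omega⟩
    · intro j hj
      rw [v14]
      exact h.stack j (by omega)
    · intro h0 v hv
      rw [v16] at h0
      rw [v14] at hv ⊢
      rcases h.closed h0 v hv with ⟨j, hj, hjv⟩ | hf | hst
      · by_cases hj' : j = s.var 15 - 1
        · subst hj'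
          exact Or.inr (Or.inl (hjv.symm.trans hu.symm))
        · exact Or.inl ⟨j, by omega, hjv⟩
      · exact hf.elim
      · exact Or.inr (Or.inr hst)
  -- the three constraints of `u`
  have hbu : ∀ {s' : State}, PropagationInv n C d L (fun v => v = u) s' →
      s'.var 14 = s.var 14 → s'.arr 7 u ≤ 2 * n := by
    intro s' h' h14
    have h1 := h'.bound u (by omega)
    have h2 := h'.raised_le u
    omega
  have b₁ := hbu h₁ v14
  obtain ⟨p₂, r₂⟩ := h₁.edge (W := W) (e := .add (.var 17) (.const 1)) (e' := .get 7 (.var 17))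
    (w := u + 1) (x := s₁.arr 7 u) hW
    (by simp only [Expr.Fits, Expr.val, v17]; omega)
    (by simp [Expr.Fits, Expr.val, State.setVar, v17]; omega)
    (by simp [Expr.val, v17]) (by simp [Expr.val, State.setVar, v17]) (by omega) (by omega)
    (fun hlt B hB => (h₁.lower B hB u (by omega)).trans (hB.mono u (by omega)))
  set s₂ := (edgeProg (.add (.var 17) (.const 1)) (.get 7 (.var 17))).exec s₁ with hs₂
  have h₂ := r₂.inv
  have u₂ : s₂.var 17 = u := r₂.var_u.trans v17
  have m₂ : s₂.var 14 = s.var 14 := r₂.var_m.trans v14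
  have b₂ := hbu h₂ m₂
  have o₂ := h₂.var_one
  obtain ⟨p₃, r₃⟩ := h₂.edge (W := W) (e := .add (.var 17) (.var 1))
    (e' := .add (.get 7 (.var 17)) (.const 1))
    (w := u + C) (x := s₂.arr 7 u + 1) hW
    (by simp only [Expr.Fits, Expr.val, u₂]; omega)
    (by simp [Expr.Fits, Expr.val, State.setVar, u₂]; omega)
    (by simp [Expr.val, u₂, o₂]) (by simp [Expr.val, State.setVar, u₂]) (by omega) (by omega)
    (fun hlt B hB => (Nat.add_le_add_right (h₂.lower B hB u (by omega)) 1).trans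
      (hB.size u (by omega)))
  set s₃ := (edgeProg (.add (.var 17) (.var 1)) (.add (.get 7 (.var 17)) (.const 1))).exec s₂
    with hs₃
  have h₃ := r₃.inv
  have u₃ : s₃.var 17 = u := r₃.var_u.trans u₂
  have m₃ : s₃.var 14 = s.var 14 := r₃.var_m.trans m₂
  have b₃ := hbu h₃ m₃
  have o₃ := h₃.var_d
  have L₃ := h₃.arr_L
  have hLu := hL u (by omega)
  obtain ⟨p₄, r₄⟩ := h₃.edge (W := W) (e := .get 6 (.var 17))
    (e' := .sub (.get 7 (.var 17)) (.var 13))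
    (w := L u) (x := s₃.arr 7 u - d) hW
    (by simp only [Expr.Fits, Expr.val, u₃, L₃]; omega)
    (by simp [Expr.Fits, Expr.val, State.setVar, u₃, o₃]; omega)
    (by simp [Expr.val, u₃, L₃]) (by simp [Expr.val, State.setVar, u₃, o₃]) (by omega) (by omega)
    (fun hlt B hB => by
      have h1 := h₃.lower B hB u (by omega)
      have h2 := hB.span u (by omega)
      omega)
  set s₄ := (edgeProg (.get 6 (.var 17)) (.sub (.get 7 (.var 17)) (.var 13))).exec s₃ with hs₄
  have h₄ := r₄.inv
  have m₄ : s₄.var 14 = s.var 14 := r₄.var_m.trans m₃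
  have f₁ : (s.setVar 15 (s.var 15 - 1)).arr 9 ((s.setVar 15 (s.var 15 - 1)).var 15) = u := by
    simp [State.setVar, hu]
  have g₁ : Prog.exec (.assign 17 (.get 9 (.var 15)))
      (Prog.exec (.assign 15 (.sub (.var 15) (.const 1))) s) = s₁ := by
    show (s.setVar 15 (s.var 15 - 1)).setVar 17
      ((s.setVar 15 (s.var 15 - 1)).arr 9 ((s.setVar 15 (s.var 15 - 1)).var 15)) = s₁
    rw [f₁]
  have hexec : popProg.exec s = s₄ := by
    simp only [popProg, Prog.exec] at g₁ ⊢
    rw [g₁]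
  refine ⟨?_, ?_⟩
  · simp only [popProg, Prog.Safe] at g₁ ⊢
    rw [g₁]
    refine ⟨?_, ?_, p₂, p₃, p₄⟩
    · simp only [Expr.Fits]
      omega
    · simp only [Expr.Fits, Expr.val, Prog.exec]
      rw [f₁]
      simp [State.setVar]
      omega
  rw [hexec]
  have e₂ : s₂.arr 7 u = s₁.arr 7 u := r₂.eq u (Or.inl (by omega))
  have e₃ : s₃.arr 7 u = s₂.arr 7 u := r₃.eq u (Or.inl (by omega))
  have e₄ : s₄.arr 7 u = s₃.arr 7 u := by
    refine r₄.eq u ?_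
    -- When `L u = u` the demand is the value at `u` minus `d`, which asks for nothing.
    by_cases hh : u = L u
    · right
      rw [← hh]
      omega
    · exact Or.inl hh
  refine ⟨⟨h₄.var_zero, h₄.var_one, h₄.var_d, h₄.arr_L, h₄.m_le, h₄.stack, h₄.raised_le,
    h₄.raised_zero, h₄.start, h₄.bound, h₄.lower, h₄.upper, ?_, h₄.failed, h₄.flag_le,
    h₄.potential⟩, ?_⟩
  · intro h0 v hv
    rcases h₄.closed h0 v hv with hst | rfl | hst
    · exact Or.inl hst
    · obtain ⟨h0₃, c₄⟩ := r₄.flag h0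
      obtain ⟨h0₂, c₃⟩ := r₃.flag h0₃
      obtain ⟨-, c₂⟩ := r₂.flag h0₂
      refine Or.inr (Or.inr ⟨fun hlt => ?_, fun hlt => ?_, ?_⟩)
      · have h1 := c₂ (by omega)
        have h2 := r₃.le (v + 1)
        have h3 := r₄.le (v + 1)
        omega
      · have h1 := c₃ (by omega)
        have h3 := r₄.le (v + C)
        omega
      · have h1 := c₄ (by omega)
        omega
    · exact Or.inr (Or.inr hst)
  · have := r₂.pot
    have := r₃.pot
    have := r₄.pot
    omega

/-- Put a new position on the stack, with the least value that the positions before it allow. -/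
def pushProg : Prog :=
  .seq (.seq (.assign 19 (.get 7 (.sub (.var 14) (.const 1))))
      (.ite (.var 14) (.var 1) .skip
        (.ite (.var 19) (.add (.get 7 (.sub (.var 14) (.var 1))) (.const 1))
          (.assign 19 (.add (.get 7 (.sub (.var 14) (.var 1))) (.const 1))) .skip)))
    (.seq (.store 7 (.var 14) (.var 19))
      (.seq (.store 9 (.const 0) (.var 14))
        (.seq (.assign 15 (.const 1)) (.assign 14 (.add (.var 14) (.const 1))))))

/-- With an empty stack and no failure, the current values form a blocking of the first `m`
positions, so `IsBlocking.exists_le` yields `upper` at the new one. The potential falls because a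
position to come counts two and a stack entry one. -/
theorem PropagationInv.push {n C d W : ℕ} {L : ℕ → ℕ} {s : State}
    (h : PropagationInv n C d L (fun _ => False) s) (hW : 8 * (n + C) + 8 ≤ W) (hC : 0 < C)
    (hL : ∀ i < n, L i ≤ i) (hsp : s.var 15 = 0) (hmn : s.var 14 < n) :
    pushProg.Safe W s ∧ PropagationInv n C d L (fun _ => False) (pushProg.exec s) ∧
      propagationPotential n (pushProg.exec s) < propagationPotential n s := by
  obtain ⟨m, hm⟩ : ∃ m, s.var 14 = m := ⟨_, rfl⟩
  have v1 := h.var_one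
  have hbW : ∀ v, v < m → s.arr 7 v ≤ 2 * n := fun v hv => by
    have h1 := h.bound v (by omega)
    have h2 := h.raised_le v
    omega
  have hb1 : s.arr 7 (m - 1) ≤ 2 * n := by
    rcases Nat.eq_zero_or_pos m with h0 | h0
    -- For the first position the truncated index `m - 1` reads the cell of the position itself,
    -- which is still `0`.
    · have h1 := h.start (by omega)
      subst h0
      simp only [Nat.zero_sub]
      omega
    · exact hbW _ (by omega)
  obtain ⟨x, hx⟩ : ∃ x, x = if m < C then s.arr 7 (m - 1) else
    max (s.arr 7 (m - 1)) (s.arr 7 (m - C) + 1) := ⟨_, rfl⟩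
  have hx1 : s.arr 7 (m - 1) ≤ x := by
    rw [hx]; split_ifs <;> omega
  have hx2 : C ≤ m → s.arr 7 (m - C) + 1 ≤ x := by
    intro hCm
    rw [hx, if_neg (by omega)]
    omega
  have hx3 : x = s.arr 7 (m - 1) ∨ C ≤ m ∧ x = s.arr 7 (m - C) + 1 := by
    rw [hx]; split_ifs <;> omega
  set s₁ := Prog.exec (.seq (.assign 19 (.get 7 (.sub (.var 14) (.const 1))))
      (.ite (.var 14) (.var 1) .skip
        (.ite (.var 19) (.add (.get 7 (.sub (.var 14) (.var 1))) (.const 1))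
          (.assign 19 (.add (.get 7 (.sub (.var 14) (.var 1))) (.const 1))) .skip))) s with hs₁
  have e₁ : s₁ = s.setVar 19 x := by
    rw [hs₁, hx]
    simp only [Prog.exec, Expr.val, State.setVar]
    simp only [hm, v1, Function.update_apply]
    simp
    split_ifs with h1 h2
    · rfl
    · rw [max_eq_right (by omega)]
    · rw [max_eq_left (by omega)]
  have e : pushProg.exec s = ⟨Function.update (Function.update (Function.update s.var 19 x)
      15 1) 14 (m + 1), Function.update (Function.update s.arr 7
        (Function.update (s.arr 7) m x)) 9 (Function.update (s.arr 9) 0 m)⟩ := by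
    show Prog.exec (.seq (.store 7 (.var 14) (.var 19))
      (.seq (.store 9 (.const 0) (.var 14))
        (.seq (.assign 15 (.const 1)) (.assign 14 (.add (.var 14) (.const 1)))))) s₁ = _
    rw [e₁]
    simp [Prog.exec, Expr.val, State.setVar, State.setArr, hm]
  have hxn : x ≤ 2 * n + 1 := by
    rcases hx3 with hx3 | ⟨h1, hx3⟩
    · omega
    · have := hbW (m - C) (by omega)
      omega
  constructor
  · have hs2 : Prog.Safe W (.seq (.store 7 (.var 14) (.var 19))
      (.seq (.store 9 (.const 0) (.var 14))
        (.seq (.assign 15 (.const 1)) (.assign 14 (.add (.var 14) (.const 1)))))) s₁ := by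
      rw [e₁]
      simp [Prog.Safe, Prog.exec, Expr.Fits, Expr.val, State.setVar, State.setArr, hm]
      omega
    refine ⟨?_, hs2⟩
    have hmC : C ≤ m → s.arr 7 (m - C) ≤ 2 * n := fun _ => hbW _ (by omega)
    simp only [Prog.Safe, Prog.exec, Expr.Fits, Expr.val, State.setVar]
    simp [hm, v1]
    omega
  set s' := pushProg.exec s
  have ev : ∀ i, i ≠ 14 → i ≠ 15 → i ≠ 19 → s'.var i = s.var i := fun i h1 h2 h3 => by
    rw [e]
    simp [h1, h2, h3]
  have e14 : s'.var 14 = m + 1 := by simp [e]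
  have e15 : s'.var 15 = 1 := by simp [e]
  have e16 : s'.var 16 = s.var 16 := ev 16 (by decide) (by decide) (by decide)
  have e6 : s'.arr 6 = s.arr 6 := by simp [e]
  have e7 : s'.arr 7 = Function.update (s.arr 7) m x := by simp [e]
  have e8 : s'.arr 8 = s.arr 8 := by simp [e]
  have e9 : s'.arr 9 = Function.update (s.arr 9) 0 m := by simp [e]
  have hne : ∀ v, v < m → s'.arr 7 v = s.arr 7 v := fun v hv => by
    rw [e7, Function.update_of_ne (by omega)]
  have hpot : propagationPotential n s' < propagationPotential n s := by
    simp only [propagationPotential, e14, e15, e8]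
    omega
  have hst : s.var 16 = 0 → ∀ v < m, IsStable m C d L (s.arr 7) v := by
    intro h0 v hv
    rcases h.closed h0 v (by omega) with ⟨j, hj, -⟩ | hf | hst
    · omega
    · exact hf.elim
    · rwa [hm] at hst
  have r0 : s.arr 8 m = 0 := h.raised_zero m (by omega)
  refine ⟨⟨(ev 0 (by decide) (by decide) (by decide)).trans h.var_zero,
      (ev 1 (by decide) (by decide) (by decide)).trans h.var_one,
      (ev 13 (by decide) (by decide) (by decide)).trans h.var_d, e6.trans h.arr_L, by omega,
      ?_, e8 ▸ h.raised_le, ?_, ?_, ?_, ?_, ?_, ?_, e16 ▸ h.failed, e16 ▸ h.flag_le,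
      hpot.le.trans h.potential⟩, hpot⟩
  · intro j hj
    obtain rfl : j = 0 := by omega
    rw [e9, e14]
    simp
  · intro v hv
    rw [e8]
    exact h.raised_zero v (by omega)
  · omega
  · intro v hv
    rcases Nat.lt_or_ge v m with hvm | hvm
    · rw [hne v hvm, e8]
      exact h.bound v (by omega)
    · obtain rfl : v = m := by omega
      rw [e7, e8, Function.update_self]
      rcases Nat.eq_zero_or_pos v with h0 | h0
      · have := h.start (by omega)
        subst h0
        rcases hx3 with hx3 | hx3
        · simp only [Nat.zero_sub] at hx3
          omega
        · omega
      -- Both sources lie at least one position back, so their bound has room for the possible raise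
      -- there and for the unit of the size constraint.
      rcases hx3 with hx3 | ⟨hCv, hx3⟩
      · have h1 := h.bound (v - 1) (by omega)
        have h2 := h.raised_le (v - 1)
        omega
      · have h1 := h.bound (v - C) (by omega)
        have h2 := h.raised_le (v - C)
        omega
  · intro B hB v hv
    rcases Nat.lt_or_ge v m with hvm | hvm
    · rw [hne v hvm]
      exact h.lower B hB v (by omega)
    · obtain rfl : v = m := by omega
      rw [e7, Function.update_self]
      rcases Nat.eq_zero_or_pos v with h0 | h0
      · have := h.start (by omega)
        subst h0
        rcases hx3 with hx3 | hx3
        · simp only [Nat.zero_sub] at hx3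
          omega
        · omega
      rcases hx3 with hx3 | ⟨hCv, hx3⟩
      · have h1 := h.lower B hB (v - 1) (by omega)
        have h2 := hB.mono (v - 1) (by omega)
        rw [Nat.sub_add_cancel h0] at h2
        omega
      · have h1 := h.lower B hB (v - C) (by omega)
        have h2 := hB.size (v - C) (by omega)
        rw [Nat.sub_add_cancel hCv] at h2
        omega
  · intro B hB v hv
    rcases Nat.lt_or_ge v m with hvm | hvm
    · rw [hne v hvm, e8]
      exact h.upper B hB v (by omega)
    · obtain rfl : v = m := by omega
      -- The existence of `B` rules out an earlier failure, so the old values are stable.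
      have h0 : s.var 16 = 0 := by
        by_contra h0
        exact h.failed h0 B hB
      obtain ⟨B', hB', hle⟩ := hB.exists_le hC hL (IsStable.isBlocking (hst h0)) (x := x) (fun _ => hx1)
      refine ⟨B', hB', ?_⟩
      rw [e7, e8, Function.update_self, r0]
      exact hle
  · intro h0 v hv
    rw [e16] at h0
    rcases Nat.lt_or_ge v m with hvm | hvm
    · obtain ⟨t1, t2, t3⟩ := hst h0 v hvm
      have hLv := hL v (by omega)
      refine Or.inr (Or.inr ⟨fun hlt => ?_, fun hlt => ?_, ?_⟩)
      · rw [hne v hvm]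
        rcases Nat.lt_or_ge (v + 1) m with h1 | h1
        · rw [hne _ h1]
          exact t1 h1
        · obtain rfl : v + 1 = m := by omega
          rw [e7, Function.update_self]
          exact hx1
      · rw [hne v hvm]
        rcases Nat.lt_or_ge (v + C) m with h1 | h1
        · rw [hne _ h1]
          exact t2 h1
        · obtain rfl : v + C = m := by omega
          rw [e7, Function.update_self]
          simpa using hx2 (by omega)
      · rw [hne v hvm, hne _ (by omega)]
        exact t3
    · obtain rfl : v = m := by omega
      exact Or.inl ⟨0, by omega, by rw [e9]; simp⟩

/-- Compute the least blocking, or find that there is none. -/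
def propagationProg : Prog :=
  .while (.const 0) (.add (.sub (.var 0) (.var 14)) (.var 15))
    (.ite (.const 0) (.var 15) popProg pushProg)

/-- Every pass pops or pushes and lowers a potential that starts at no more than `3 * n`. A failure
only sets a flag and does not stop the loop. At the end all positions are in use and the stack is
empty, so without failure every constraint holds. -/
theorem propagationProg_reaches {n C d W : ℕ} {s : State} (hW : 8 * (n + C) + 8 ≤ W)
    (hC : 0 < C) (hd : d ≤ n) (hL : ∀ i < n, s.arr 6 i ≤ i) (h0 : s.var 0 = n) (h1 : s.var 1 = C)
    (h13 : s.var 13 = d) (hv : ∀ i ∈ [14, 15, 16], s.var i = 0)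
    (ha : ∀ a ∈ [7, 8], ∀ j, s.arr a j = 0) :
    propagationProg.Reaches W s (1000 * (n + 1)) fun s' =>
      (s'.var 16 = 0 → IsBlocking n C d (s.arr 6) (s'.arr 7) ∧ ∀ i < n, s'.arr 7 i ≤ 2 * n) ∧
      (s'.var 16 ≠ 0 → ∀ B, ¬ IsBlocking n C d (s.arr 6) B) ∧ s'.var 16 ≤ 1 := by
  simp only [List.forall_mem_cons, List.not_mem_nil, false_imp_iff, implies_true, and_true] at hv ha
  obtain ⟨v14, v15, v16⟩ := hv
  obtain ⟨a7, a8⟩ := ha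
  have hp : propagationPotential n s ≤ 3 * n := by
    have : unraised n (s.arr 8) ≤ n := (Finset.card_filter_le _ _).trans (by simp)
    unfold propagationPotential
    omega
  refine Prog.reaches_while (PropagationInv n C d (s.arr 6) fun _ => False)
    (propagationPotential n) ?_ ?_ ?_ ?_
  · refine ⟨h0, h1, h13, rfl, by omega, by omega, fun v => by rw [a8]; omega, fun v _ => a8 v,
      fun _ => a7 0, by omega, fun _ _ => by omega, fun _ _ => by omega, fun _ => by omega,
      by omega, by omega, hp⟩
  · intro s' _ h
    have hm := h.m_le
    have hz := h.var_zero
    have hsp : s'.var 15 ≤ 3 * n := by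
      have := h.potential
      unfold propagationPotential at this
      omega
    refine ⟨Nat.zero_le _, ?_, fun hlt => ?_⟩
    · simp only [Expr.Fits, Expr.val]
      omega
    · simp only [Expr.val] at hlt
      simp only [Prog.Safe, Prog.exec, Expr.Fits, Expr.val]
      by_cases h15 : 0 < s'.var 15
      · simp only [h15, if_true, not_true, false_imp_iff, and_true, true_imp_iff]
        obtain ⟨p1, p2, p3⟩ := h.pop hW hC hd hL h15
        exact ⟨⟨Nat.zero_le _, by omega, p1⟩, p2, p3⟩
      · simp only [h15, if_false, not_false_iff, false_imp_iff, true_and, true_imp_iff]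
        obtain ⟨p1, p2, p3⟩ := h.push hW hC hL (by omega) (by omega)
        exact ⟨⟨Nat.zero_le _, by omega, p1⟩, p2, p3⟩
  · calc _ ≤ (3 * n + 1) * 300 := Nat.mul_le_mul (by omega) (by decide)
      _ ≤ _ := by omega
  · intro s' _ h hlt
    have hz := h.var_zero
    have hm := h.m_le
    simp only [Expr.val] at hlt
    have h14 : s'.var 14 = n := by omega
    refine ⟨fun hf => ⟨IsStable.isBlocking fun v hv => ?_, fun i hi => ?_⟩, h.failed, h.flag_le⟩
    · rcases h.closed hf v (by omega) with ⟨j, hj, -⟩ | hF | hst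
      · omega
      · exact hF.elim
      · rwa [h14] at hst
    · have h2 := h.bound i (by omega)
      have h3 := h.raised_le i
      omega

end RAM

/-! ### Counting sort and the largest window -/

section Count

variable {n : ℕ}

/-- The number of indices at which `l` is less than `x`. -/
def countLt (l : Fin n → ℕ) (x : ℕ) : ℕ := (Finset.univ.filter fun w => l w < x).card

/-- The number of indices before `i` at which `l` equals `x`. -/
def countEq (l : Fin n → ℕ) (i x : ℕ) : ℕ :=
  (Finset.univ.filter fun w : Fin n => (w : ℕ) < i ∧ l w = x).card

theorem countLt_succ (l : Fin n → ℕ) (x : ℕ) : countLt l (x + 1) = countLt l x + countEq l n x := by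
  unfold countLt countEq
  rw [← Finset.card_union_of_disjoint]
  · congr 1
    ext w
    have := w.2
    simp only [Finset.mem_filter, Finset.mem_univ, true_and, Finset.mem_union]
    omega
  · rw [Finset.disjoint_filter]
    omega

theorem countEq_succ (l : Fin n → ℕ) {i : ℕ} (hi : i < n) (x : ℕ) :
    countEq l (i + 1) x = countEq l i x + if x = l ⟨i, hi⟩ then 1 else 0 := by
  unfold countEq
  split_ifs with hx
  · have : (Finset.univ.filter fun w : Fin n => (w : ℕ) < i + 1 ∧ l w = x) =
        insert ⟨i, hi⟩ (Finset.univ.filter fun w : Fin n => (w : ℕ) < i ∧ l w = x) := by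
      ext w
      simp only [Finset.mem_filter, Finset.mem_univ, true_and, Finset.mem_insert, Fin.ext_iff]
      constructor
      · intro h
        omega
      · rintro (h | h)
        · obtain rfl : w = ⟨i, hi⟩ := Fin.ext h
          exact ⟨by simp, hx.symm⟩
        · omega
    rw [this, Finset.card_insert_of_notMem (by simp)]
  · rw [add_zero]
    congr 1
    ext w
    simp only [Finset.mem_filter, Finset.mem_univ, true_and]
    constructor
    · intro h
      refine ⟨?_, h.2⟩
      by_contra hge
      obtain rfl : w = ⟨i, hi⟩ := Fin.ext (by simp only; omega)
      exact hx h.2.symm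
    · omega

theorem countEq_zero (l : Fin n → ℕ) (x : ℕ) : countEq l 0 x = 0 := by
  simp [countEq]

theorem countLt_zero (l : Fin n → ℕ) : countLt l 0 = 0 := by
  simp [countLt]

theorem countEq_le (l : Fin n → ℕ) (i x : ℕ) : countEq l i x ≤ n :=
  (Finset.card_filter_le _ _).trans (by simp)

theorem countLt_le (l : Fin n → ℕ) (x : ℕ) : countLt l x ≤ n :=
  (Finset.card_filter_le _ _).trans (by simp)

/-- The test of the prefix loop: it goes on exactly while some left endpoint has not been passed. -/
theorem countLt_lt_iff (l : Fin n → ℕ) (x : ℕ) : countLt l x < n ↔ ∃ v, x ≤ l v := by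
  constructor
  · intro h
    by_contra! hcon
    have : countLt l x = n := by simp [countLt, hcon]
    omega
  · rintro ⟨v, hv⟩
    have : countLt l x < (Finset.univ : Finset (Fin n)).card :=
      Finset.card_lt_card (Finset.filter_ssubset.2 ⟨v, Finset.mem_univ _, by omega⟩)
    simpa using this

theorem stableRank_eq (l : Fin n → ℕ) (v : Fin n) :
    stableRank l v = countLt l (l v) + countEq l v (l v) := rfl

end Count

namespace RAM

/-- Count how often each number is a left or a right endpoint. -/
def countProg : Prog :=
  .while (.var 3) (.var 0)
    (.seq (.store 3 (.get 0 (.var 3)) (.add (.get 3 (.get 0 (.var 3))) (.const 1)))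
      (.seq (.store 4 (.get 1 (.var 3)) (.add (.get 4 (.get 1 (.var 3))) (.const 1)))
        (.assign 3 (.add (.var 3) (.const 1)))))

variable {n C W : ℕ} {l r : Fin n → ℕ} {s : State}

theorem countProg_reaches (hW : 8 * (n + C) + 8 ≤ W) (hl : ∀ v, l v ≤ W) (hr : ∀ v, r v ≤ W)
    (h0 : s.var 0 = n) (h3 : s.var 3 = 0) (hal : ∀ v : Fin n, s.arr 0 v = l v)
    (har : ∀ v : Fin n, s.arr 1 v = r v) (ha : ∀ a ∈ [3, 4], ∀ j, s.arr a j = 0) :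
    countProg.Reaches W s (100 * (n + 1)) fun s' =>
      ∀ x, s'.arr 3 x = countEq l n x ∧ s'.arr 4 x = countEq r n x := by
  simp only [List.forall_mem_cons, List.not_mem_nil, false_imp_iff, implies_true, and_true] at ha
  refine Prog.reaches_while (fun s' => s'.var 3 ≤ n ∧ ∀ x,
    s'.arr 3 x = countEq l (s'.var 3) x ∧ s'.arr 4 x = countEq r (s'.var 3) x)
    (fun s' => n - s'.var 3) ?_ ?_ ?_ ?_
  · refine ⟨by omega, fun x => ?_⟩
    rw [ha.1, ha.2, h3, countEq_zero, countEq_zero]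
    exact ⟨rfl, rfl⟩
  · rintro s' hf ⟨hi, hx⟩
    have e0 := (hf.1 0 (by decide)).trans h0
    have f0 := hf.2 0 (by decide)
    have f1 := hf.2 1 (by decide)
    obtain ⟨i, hi'⟩ : ∃ i, s'.var 3 = i := ⟨_, rfl⟩
    rw [hi'] at hi hx
    simp only [Expr.Fits, Expr.val, e0, hi']
    refine ⟨by omega, by omega, fun hlt => ?_⟩
    have k1 := hal ⟨i, hlt⟩
    have k2 := har ⟨i, hlt⟩
    simp only at k1 k2
    have b1 := hl ⟨i, hlt⟩
    have b2 := hr ⟨i, hlt⟩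
    have c1 := (hx (l ⟨i, hlt⟩)).1
    have c2 := (hx (r ⟨i, hlt⟩)).2
    have d1 := countEq_le l i (l ⟨i, hlt⟩)
    have d2 := countEq_le r i (r ⟨i, hlt⟩)
    refine ⟨?_, ⟨?_, fun x => ?_⟩, ?_⟩
    · simp [Prog.Safe, Prog.exec, Expr.Fits, Expr.val, State.setArr, hi', f0, f1, k1, k2]
      omega
    · simp [Prog.exec, Expr.val, State.setArr, State.setVar, hi']
      omega
    · simp [Prog.exec, Expr.val, State.setArr, State.setVar, hi', f0, f1, k1, k2,
        countEq_succ _ hlt, Function.update_apply, hx]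
      constructor <;> split_ifs with h <;> simp [h]
    · simp [Prog.exec, Expr.val, State.setArr, State.setVar, hi']
      omega
  · calc _ ≤ (n + 1) * 100 := Nat.mul_le_mul (by omega) (by decide)
      _ ≤ _ := by omega
  · rintro s' hf ⟨hi, hx⟩ hlt
    have e0 := (hf.1 0 (by decide)).trans h0
    simp only [Expr.val] at hlt
    rw [show s'.var 3 = n by omega] at hx
    exact hx

/-- Replace the numbers of endpoints by the numbers of smaller endpoints. -/
def prefixProg : Prog :=
  .while (.var 5) (.var 0)
    (.seq (.assign 7 (.get 3 (.var 4)))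
      (.seq (.store 3 (.var 4) (.var 5))
        (.seq (.assign 5 (.add (.var 5) (.var 7)))
          (.seq (.assign 7 (.get 4 (.var 4)))
            (.seq (.store 4 (.var 4) (.var 6))
              (.seq (.assign 6 (.add (.var 6) (.var 7)))
                (.assign 4 (.add (.var 4) (.const 1)))))))))

/-- The sums overwrite the counts in place: cells below variable `4` hold sums, the others still
hold counts. Sums for right endpoints are needed only at left endpoints, so stopping after the last
left endpoint is enough. -/
theorem prefixProg_reaches {M : ℕ} (hW : 8 * (n + C) + 8 ≤ W) (hM : M + 8 ≤ W)
    (hl : ∀ v, l v ≤ M) (h0 : s.var 0 = n) (hv : ∀ i ∈ [4, 5, 6], s.var i = 0)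
    (h3 : ∀ x, s.arr 3 x = countEq l n x) (h4 : ∀ x, s.arr 4 x = countEq r n x) :
    prefixProg.Reaches W s (100 * (M + 2)) fun s' => ∀ v,
      s'.arr 3 (l v) = countLt l (l v) ∧ s'.arr 4 (l v) = countLt r (l v) := by
  simp only [List.forall_mem_cons, List.not_mem_nil, false_imp_iff, implies_true, and_true] at hv
  obtain ⟨v4, v5, v6⟩ := hv
  refine Prog.reaches_while (fun s' => s'.var 4 ≤ M + 1 ∧ s'.var 5 = countLt l (s'.var 4) ∧
    s'.var 6 = countLt r (s'.var 4) ∧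
    (∀ x < s'.var 4, s'.arr 3 x = countLt l x ∧ s'.arr 4 x = countLt r x) ∧
    (∀ x, s'.var 4 ≤ x → s'.arr 3 x = countEq l n x ∧ s'.arr 4 x = countEq r n x))
    (fun s' => M + 1 - s'.var 4) ?_ ?_ ?_ ?_
  · rw [v4, v5, v6, countLt_zero, countLt_zero]
    exact ⟨by omega, rfl, rfl, fun x hx => by omega, fun x _ => ⟨h3 x, h4 x⟩⟩
  · rintro s' hf ⟨hy, h5, h6, hlt, hge⟩
    have e0 := (hf.1 0 (by decide)).trans h0
    obtain ⟨y, hy'⟩ : ∃ y, s'.var 4 = y := ⟨_, rfl⟩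
    rw [hy'] at hy h5 h6 hlt hge
    have b5 := countLt_le l y
    have b6 := countLt_le r y
    obtain ⟨c3, c4⟩ := hge y le_rfl
    simp only [Expr.Fits, Expr.val, e0, h5]
    refine ⟨by omega, by omega, fun hn => ?_⟩
    obtain ⟨v, hv⟩ := (countLt_lt_iff l y).1 hn
    have hvM := hl v
    have d3 := countEq_le l n y
    have d4 := countEq_le r n y
    refine ⟨?_, ⟨?_, ?_, ?_, fun x hx => ?_, fun x hx => ?_⟩, ?_⟩
    · simp [Prog.Safe, Prog.exec, Expr.Fits, Expr.val, State.setArr, State.setVar, hy', h5, h6,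
        c3, c4]
      omega
    · simp [Prog.exec, Expr.val, State.setArr, State.setVar, hy']
      omega
    · simp [Prog.exec, Expr.val, State.setArr, State.setVar, hy', h5, c3, countLt_succ]
    · simp [Prog.exec, Expr.val, State.setArr, State.setVar, hy', h6, c4, countLt_succ]
    · simp [Prog.exec, Expr.val, State.setArr, State.setVar, hy', h5, h6,
        Function.update_apply] at hx ⊢
      by_cases hxy : x = y
      · simp [hxy]
      · simp [hxy, hlt x (by omega)]
    · simp [Prog.exec, Expr.val, State.setArr, State.setVar, hy', h5, h6,
        Function.update_apply] at hx ⊢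
      have hxy : x ≠ y := by omega
      simp [hxy, hge x (by omega)]
    · simp [Prog.exec, Expr.val, State.setArr, State.setVar, hy']
      omega
  · calc _ ≤ (M + 2) * 100 := Nat.mul_le_mul (by omega) (by decide)
      _ ≤ _ := by omega
  · rintro s' hf ⟨hy, h5, h6, hlt, hge⟩ hn v
    have e0 := (hf.1 0 (by decide)).trans h0
    simp only [Expr.val, e0, h5, countLt_lt_iff] at hn
    push Not at hn
    exact hlt _ (hn v)

/-- Sort the vertices by their left endpoints, find for each position the number of positions
before the neighbours, and compute the largest size of a clique. -/
def rankProg : Prog :=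
  .while (.var 8) (.var 0)
    (.seq (.assign 9 (.get 3 (.get 0 (.var 8))))
      (.seq (.store 5 (.var 8) (.var 9))
        (.seq (.store 6 (.var 9) (.get 4 (.get 0 (.var 8))))
          (.seq (.store 3 (.get 0 (.var 8)) (.add (.var 9) (.const 1)))
            (.seq (.assign 11 (.sub (.add (.var 9) (.const 1)) (.get 6 (.var 9))))
              (.seq (.assign 10 (.add (.var 10) (.sub (.var 11) (.var 10))))
                (.assign 8 (.add (.var 8) (.const 1)))))))))

/-- Cell `l v` of array `3` is the next free position for that left endpoint; it equals `stableRank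
l v` when `v` is reached. Variable `10` is a running maximum, since `a + (b - a)` with truncated
subtraction is `max a b`. -/
theorem rankProg_reaches (hW : 8 * (n + C) + 8 ≤ W) (hl : ∀ v, l v ≤ W)
    (h0 : s.var 0 = n) (hv : ∀ i ∈ [8, 10], s.var i = 0) (hal : ∀ v : Fin n, s.arr 0 v = l v)
    (h3 : ∀ v, s.arr 3 (l v) = countLt l (l v)) (h4 : ∀ v, s.arr 4 (l v) = countLt r (l v)) :
    rankProg.Reaches W s (200 * (n + 1)) fun s' =>
      (∀ v : Fin n, s'.arr 5 v = stableRank l v) ∧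
      (∀ v, s'.arr 6 (stableRank l v) = countLt r (l v)) ∧
      (∀ i < n, i + 1 - s'.arr 6 i ≤ s'.var 10) ∧
      ∀ X, (∀ i < n, i + 1 - s'.arr 6 i ≤ X) → s'.var 10 ≤ X := by
  simp only [List.forall_mem_cons, List.not_mem_nil, false_imp_iff, implies_true, and_true] at hv
  obtain ⟨v8, v10⟩ := hv
  refine Prog.reaches_while (fun s' => s'.var 8 ≤ n ∧
    (∀ v, s'.arr 3 (l v) = countLt l (l v) + countEq l (s'.var 8) (l v)) ∧
    (∀ v : Fin n, (v : ℕ) < s'.var 8 → s'.arr 5 v = stableRank l v ∧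
      s'.arr 6 (stableRank l v) = countLt r (l v) ∧
      stableRank l v + 1 - countLt r (l v) ≤ s'.var 10) ∧
    s'.var 10 ≤ n ∧
    ∀ X, (∀ v, stableRank l v + 1 - countLt r (l v) ≤ X) → s'.var 10 ≤ X)
    (fun s' => n - s'.var 8) ?_ ?_ ?_ ?_
  · refine ⟨by omega, fun v => ?_, fun v hv => by omega, by omega, fun X _ => by omega⟩
    rw [h3, v8, countEq_zero, add_zero]
  · rintro s' hf ⟨hi, hc, hr, hω, hX⟩
    have e0 := (hf.1 0 (by decide)).trans h0
    have f0 := hf.2 0 (by decide)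
    have f4 := hf.2 4 (by decide)
    obtain ⟨i, hi'⟩ : ∃ i, s'.var 8 = i := ⟨_, rfl⟩
    obtain ⟨ω, hω'⟩ : ∃ ω, s'.var 10 = ω := ⟨_, rfl⟩
    rw [hi'] at hi hc hr
    rw [hω'] at hω hX hr
    simp only [Expr.Fits, Expr.val, e0, hi']
    refine ⟨by omega, by omega, fun hlt => ?_⟩
    obtain ⟨v, hv⟩ : ∃ v : Fin n, v = ⟨i, hlt⟩ := ⟨_, rfl⟩
    have hvi : (v : ℕ) = i := by rw [hv]
    have k1 : s.arr 0 i = l v := hvi ▸ hal v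
    have b1 := hl v
    have c3 : s'.arr 3 (l v) = stableRank l v := by rw [hc, stableRank_eq, hvi]
    have c4 := h4 v
    have b4 := countLt_le r (l v)
    have b3 := stableRank_lt_card l v
    obtain ⟨q, hq⟩ : ∃ q, q = stableRank l v := ⟨_, rfl⟩
    rw [← hq] at b3 c3
    refine ⟨?_, ⟨?_, fun w => ?_, fun w hw => ?_, ?_, fun X hX' => ?_⟩, ?_⟩
    · simp [Prog.Safe, Prog.exec, Expr.Fits, Expr.val, State.setArr, State.setVar, hi', hω', f0,
        f4, k1, c3, c4]
      omega
    · simp [Prog.exec, Expr.val, State.setArr, State.setVar, hi']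
      omega
    · simp [Prog.exec, Expr.val, State.setArr, State.setVar, hi', f0, k1, c3,
        Function.update_apply, countEq_succ _ hlt, ← hv, hc]
      split_ifs with h
      · rw [h, hq, stableRank_eq, hvi, add_assoc]
      · rfl
    · simp [Prog.exec, Expr.val, State.setArr, State.setVar, hi', hω', f0, f4, k1, c3, c4,
        Function.update_apply] at hw ⊢
      by_cases hwv : w = v
      · subst hwv
        simp [hvi, hq]
        omega
      · have hwv' : (w : ℕ) ≠ v := fun h => hwv (Fin.ext h)
        have hne : stableRank l w ≠ q := hq ▸ (stableRank_injective l).ne hwv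
        obtain ⟨r1, r2, r3⟩ := hr w (by omega)
        rw [if_neg (by omega), if_neg hne]
        exact ⟨r1, r2, by omega⟩
    · simp [Prog.exec, Expr.val, State.setArr, State.setVar, hi', hω', f0, f4, k1, c3, c4]
      omega
    · have h1 := hX X hX'
      have h2 := hX' v
      simp [Prog.exec, Expr.val, State.setArr, State.setVar, hi', hω', f0, f4, k1, c3, c4]
      omega
    · simp [Prog.exec, Expr.val, State.setArr, State.setVar, hi']
      omega
  · calc _ ≤ (n + 1) * 200 := Nat.mul_le_mul (by omega) (by decide)
      _ ≤ _ := by omega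
  · rintro s' hf ⟨hi, hc, hr, hω, hX⟩ hlt
    have e0 := (hf.1 0 (by decide)).trans h0
    simp only [Expr.val] at hlt
    have hr' : ∀ v : Fin n, _ := fun v => hr v (by omega)
    refine ⟨fun v => (hr' v).1, fun v => (hr' v).2.1, fun i hi => ?_, fun X hX' => hX X fun v => ?_⟩
    · obtain ⟨v, rfl⟩ := exists_stableRank_eq l hi
      rw [(hr' v).2.1]
      exact (hr' v).2.2
    · rw [← (hr' v).2.1]
      exact hX' _ (stableRank_lt_card l v)

end RAM

/-! ### Quotient, fallback blocks, remainders and output -/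

namespace RAM

variable {n C W : ℕ} {s : State}

/-- Divide the largest size of a clique by the size bound and round up. -/
def quotientProg : Prog :=
  .seq (.while (.var 12) (.var 10)
      (.seq (.assign 12 (.add (.var 12) (.var 1))) (.assign 2 (.add (.var 2) (.const 1)))))
    (.assign 13 (.sub (.var 2) (.const 1)))

theorem Prog.Reaches.seq {p q : Prog} {T T' : ℕ} {Q R : State → Prop}
    (hp : p.Reaches W s T Q) (hq : ∀ s', p.Frame s s' → Q s' → q.Reaches W s' T' R) :
    (Prog.seq p q).Reaches W s (T + T') R := by
  obtain ⟨t, s', hr, ht, hf, hQ⟩ := hp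
  obtain ⟨t', s'', hr', ht', hf', hR⟩ := hq s' hf hQ
  refine ⟨_, s'', .seq _ _ _ _ _ _ _ hr hr', by omega, ⟨fun i hi => ?_, fun i hi => ?_⟩, hR⟩
  · simp only [Prog.vars, List.mem_append, not_or] at hi
    exact (hf'.1 i hi.2).trans (hf.1 i hi.1)
  · simp only [Prog.arrs, List.mem_append, not_or] at hi
    exact (hf'.2 i hi.2).trans (hf.2 i hi.1)

/-- Division by repeated addition; as `C` is positive, at most `n` additions are made. -/
theorem quotientProg_reaches (hW : 8 * (n + C) + 8 ≤ W) (hC : 0 < C) (h1 : s.var 1 = C)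
    (hv : ∀ i ∈ [2, 12], s.var i = 0) (h10 : s.var 10 ≤ n) :
    quotientProg.Reaches W s (100 * (n + 1)) fun s' =>
      s.var 10 ≤ s'.var 2 * C ∧ (∀ X, s.var 10 ≤ X * C → s'.var 2 ≤ X) ∧ s'.var 2 ≤ n ∧
        s'.var 13 = s'.var 2 - 1 := by
  simp only [List.forall_mem_cons, List.not_mem_nil, false_imp_iff, implies_true, and_true] at hv
  obtain ⟨v2, v12⟩ := hv
  have hloop : (Prog.while (.var 12) (.var 10)
      (.seq (.assign 12 (.add (.var 12) (.var 1)))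
        (.assign 2 (.add (.var 2) (.const 1))))).Reaches W s (50 * (n + 1)) fun s' =>
      s.var 10 ≤ s'.var 2 * C ∧ (∀ X, s.var 10 ≤ X * C → s'.var 2 ≤ X) ∧ s'.var 2 ≤ n := by
    refine Prog.reaches_while (fun s' => s'.var 12 = s'.var 2 * C ∧ s'.var 12 ≤ n + C ∧
      s'.var 2 ≤ n ∧ ∀ X, s.var 10 ≤ X * C → s'.var 2 ≤ X) (fun s' => n - s'.var 2) ?_ ?_ ?_ ?_
    · rw [v2, v12]
      exact ⟨by simp, by omega, by omega, fun _ _ => Nat.zero_le _⟩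
    · rintro s' hf ⟨h12, hle, h2n, hX⟩
      have e1 := (hf.1 1 (by decide)).trans h1
      have e10 := hf.1 10 (by decide)
      simp only [Expr.Fits, Expr.val, e10]
      refine ⟨by omega, by omega, fun hlt => ?_⟩
      have hq : s'.var 2 ≤ s'.var 12 := h12 ▸ Nat.le_mul_of_pos_right _ hC
      refine ⟨?_, ⟨?_, ?_, ?_, fun X hX' => ?_⟩, ?_⟩
      · simp [Prog.Safe, Prog.exec, Expr.Fits, Expr.val, State.setVar, e1]
        omega
      · simp [Prog.exec, Expr.val, State.setVar, e1, h12, Nat.add_mul]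
      · simp [Prog.exec, Expr.val, State.setVar, e1]
        omega
      · simp [Prog.exec, Expr.val, State.setVar]
        omega
      · simp [Prog.exec, Expr.val, State.setVar]
        -- A multiplier `X` that suffices is at least the current one by the invariant, and differs
        -- from it because the loop test succeeded.
        by_contra! hcon
        have h3 := hX X hX'
        obtain rfl : X = s'.var 2 := by omega
        omega
      · simp [Prog.exec, Expr.val, State.setVar]
        omega
    · calc _ ≤ (n + 1) * 50 := Nat.mul_le_mul (by omega) (by decide)
        _ ≤ _ := by omega
    · rintro s' hf ⟨h12, hle, h2n, hX⟩ hlt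
      have e10 := hf.1 10 (by decide)
      simp only [Expr.val] at hlt
      exact ⟨by omega, hX, h2n⟩
  refine Prog.Reaches.mono_time (hloop.seq (q := .assign 13 (.sub (.var 2) (.const 1))) (T' := 4)
    (R := fun s' => s.var 10 ≤ s'.var 2 * C ∧ (∀ X, s.var 10 ≤ X * C → s'.var 2 ≤ X) ∧
      s'.var 2 ≤ n ∧ s'.var 13 = s'.var 2 - 1) fun s' hf hQ => ?_) (by omega)
  · refine Prog.reaches_of_safe ?_ (by decide) ?_
    · simp only [Prog.Safe, Expr.Fits]
      omega
    · simpa [Prog.exec, Expr.val, State.setVar] using hQ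

/-- If there is no blocking, use one more color and blocks of the full size. -/
def fallbackProg : Prog :=
  .ite (.const 0) (.var 16)
    (.seq (.assign 2 (.add (.var 2) (.const 1)))
      (.while (.var 20) (.var 0)
        (.seq (.ite (.var 20) (.var 1) (.store 7 (.var 20) (.const 0))
            (.store 7 (.var 20) (.add (.get 7 (.sub (.var 20) (.var 1))) (.const 1))))
          (.assign 20 (.add (.var 20) (.const 1))))))
    .skip

theorem Prog.Reaches.ite {p q : Prog} {e₁ e₂ : Expr} {T : ℕ} {Q : State → Prop}
    (h₁ : e₁.Fits W s) (h₂ : e₂.Fits W s) (hp : e₁.val s < e₂.val s → p.Reaches W s T Q)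
    (hq : ¬ e₁.val s < e₂.val s → q.Reaches W s T Q) :
    (Prog.ite e₁ e₂ p q).Reaches W s (e₁.cost + e₂.cost + 1 + T) Q := by
  have hmem : ∀ {x : ℕ} {A B : List ℕ}, x ∉ A ++ B → x ∉ A ∧ x ∉ B := by
    intro x A B h
    simpa using h
  by_cases hlt : e₁.val s < e₂.val s
  · obtain ⟨t, s', hr, ht, hf, hQ⟩ := hp hlt
    exact ⟨_, s', .ite_true _ _ _ _ _ _ _ h₁ h₂ hlt hr, by omega,
      ⟨fun i hi => hf.1 i (hmem hi).1, fun i hi => hf.2 i (hmem hi).1⟩, hQ⟩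
  · obtain ⟨t, s', hr, ht, hf, hQ⟩ := hq hlt
    exact ⟨_, s', .ite_false _ _ _ _ _ _ _ h₁ h₂ hlt hr, by omega,
      ⟨fun i hi => hf.1 i (hmem hi).2, fun i hi => hf.2 i (hmem hi).2⟩, hQ⟩

theorem fallbackProg_reaches (hW : 8 * (n + C) + 8 ≤ W) (hC : 0 < C) (h0 : s.var 0 = n)
    (h1 : s.var 1 = C) (h2 : s.var 2 ≤ n) (h16 : s.var 16 ≤ 1) (h20 : s.var 20 = 0) :
    fallbackProg.Reaches W s (100 * (n + 1)) fun s' =>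
      (s.var 16 = 0 → s'.var 2 = s.var 2 ∧ s'.arr 7 = s.arr 7) ∧
      (s.var 16 ≠ 0 → s'.var 2 = s.var 2 + 1 ∧ ∀ i < n, s'.arr 7 i = i / C) := by
  have hmain : fallbackProg.Reaches W s (3 + (6 + 50 * (n + 1))) fun s' =>
      (s.var 16 = 0 → s'.var 2 = s.var 2 ∧ s'.arr 7 = s.arr 7) ∧
      (s.var 16 ≠ 0 → s'.var 2 = s.var 2 + 1 ∧ ∀ i < n, s'.arr 7 i = i / C) := by
    refine Prog.Reaches.ite (Nat.zero_le _) (by simp only [Expr.Fits]; omega)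
      (fun hlt => ?_) fun hlt => ?_
    · simp only [Expr.val] at hlt
      refine Prog.Reaches.seq (T := 6) (Q := fun s' => s'.var 2 = s.var 2 + 1)
        (Prog.reaches_of_safe ?_ (by decide) ?_) fun s₁ hf₁ hs₁ => ?_
      · simp only [Prog.Safe, Expr.Fits, Expr.val]
        omega
      · simp [Prog.exec, Expr.val, State.setVar]
      have g0 := (hf₁.1 0 (by decide)).trans h0
      have g1 := (hf₁.1 1 (by decide)).trans h1
      have g20 := (hf₁.1 20 (by decide)).trans h20
      refine Prog.reaches_while (fun s' => s'.var 20 ≤ n ∧ ∀ i < s'.var 20, s'.arr 7 i = i / C)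
        (fun s' => n - s'.var 20) ?_ ?_ ?_ ?_
      · exact ⟨by omega, fun i hi => by omega⟩
      · rintro s' hf ⟨hi, ha⟩
        have e0 := (hf.1 0 (by decide)).trans g0
        have e1 := (hf.1 1 (by decide)).trans g1
        obtain ⟨i, hi'⟩ : ∃ i, s'.var 20 = i := ⟨_, rfl⟩
        rw [hi'] at hi ha
        simp only [Expr.Fits, Expr.val, e0, hi']
        refine ⟨by omega, by omega, fun hin => ?_⟩
        have hexec : Prog.exec (.seq (.ite (.var 20) (.var 1) (.store 7 (.var 20) (.const 0))
            (.store 7 (.var 20) (.add (.get 7 (.sub (.var 20) (.var 1))) (.const 1))))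
            (.assign 20 (.add (.var 20) (.const 1)))) s' =
            (s'.setArr 7 i (i / C)).setVar 20 (i + 1) := by
          by_cases hiC : i < C
          · simp [Prog.exec, Expr.val, State.setVar, State.setArr, hi', e1, hiC,
              Nat.div_eq_of_lt hiC]
          -- The quotient is obtained without division from the cell `C` positions back.
          · have h3 : i / C = (i - C) / C + 1 := Nat.div_eq_sub_div hC (by omega)
            simp [Prog.exec, Expr.val, State.setVar, State.setArr, hi', e1, hiC,
              ha (i - C) (by omega), h3]
        rw [hexec]
        refine ⟨?_, ⟨?_, fun j hj => ?_⟩, ?_⟩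
        · have h3 : C ≤ i → s'.arr 7 (i - C) ≤ n := fun hCi => by
            rw [ha _ (by omega)]
            exact (Nat.div_le_self _ _).trans (by omega)
          by_cases hiC : i < C
          · simp [Prog.Safe, Prog.exec, Expr.Fits, Expr.val, State.setArr, hi', e1, hiC]
            omega
          · have := h3 (by omega)
            simp [Prog.Safe, Prog.exec, Expr.Fits, Expr.val, State.setArr, hi', e1, hiC]
            omega
        · simp [State.setVar]
          omega
        · simp [State.setVar, State.setArr, Function.update_apply] at hj ⊢
          by_cases hji : j = i
          · simp [hji]
          · rw [if_neg hji, ha j (by omega)]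
        · simp [State.setVar]
          omega
      · calc _ ≤ (n + 1) * 50 := Nat.mul_le_mul (by omega) (by decide)
          _ ≤ _ := by omega
      · rintro s' hf ⟨hi, ha⟩ hn
        have e0 := (hf.1 0 (by decide)).trans g0
        have e2 := hf.1 2 (by decide)
        simp only [Expr.val] at hn
        exact ⟨fun h => by omega, fun _ => ⟨by omega, fun i hi' => ha i (by omega)⟩⟩
    · simp only [Expr.val] at hlt
      refine Prog.reaches_of_safe trivial (by simp only [Prog.time]; omega) ?_
      exact ⟨fun _ => ⟨rfl, rfl⟩, fun h => by omega⟩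
  exact hmain.mono_time (by omega)

/-- Tabulate the remainders modulo the number of colors. -/
def remainderProg : Prog :=
  .while (.var 21) (.add (.add (.var 0) (.var 0)) (.const 1))
    (.seq (.store 10 (.var 21) (.var 22))
      (.seq (.assign 21 (.add (.var 21) (.const 1)))
        (.seq (.assign 22 (.add (.var 22) (.const 1)))
          (.ite (.var 22) (.var 2) .skip (.assign 22 (.const 0))))))

/-- A counter reset at the number of colors replaces division. Arguments up to `2 * n` suffice
because block numbers never exceed that. Without vertices the modulus is `0` and the table is
irrelevant. -/
theorem remainderProg_reaches (hW : 8 * (n + C) + 8 ≤ W) (h0 : s.var 0 = n)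
    (h2 : s.var 2 ≤ n + 1) (hpos : 0 < n → 0 < s.var 2) (hv : ∀ i ∈ [21, 22], s.var i = 0) :
    remainderProg.Reaches W s (100 * (n + 1)) fun s' =>
      0 < n → ∀ k ≤ 2 * n, s'.arr 10 k = k % s.var 2 := by
  simp only [List.forall_mem_cons, List.not_mem_nil, false_imp_iff, implies_true, and_true] at hv
  obtain ⟨v21, v22⟩ := hv
  refine Prog.reaches_while (fun s' => s'.var 21 ≤ 2 * n + 1 ∧ s'.var 22 ≤ s'.var 21 ∧
    (0 < n → s'.var 22 = s'.var 21 % s.var 2 ∧ ∀ k < s'.var 21, s'.arr 10 k = k % s.var 2))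
    (fun s' => 2 * n + 1 - s'.var 21) ?_ ?_ ?_ ?_
  · rw [v21, v22]
    exact ⟨by omega, by omega, fun _ => ⟨by simp, fun k hk => by omega⟩⟩
  · rintro s' hf ⟨hk, hck, hc⟩
    have e0 := (hf.1 0 (by decide)).trans h0
    have e2 := hf.1 2 (by decide)
    obtain ⟨k, hk'⟩ : ∃ k, s'.var 21 = k := ⟨_, rfl⟩
    obtain ⟨c, hc'⟩ : ∃ c, s'.var 22 = c := ⟨_, rfl⟩
    obtain ⟨m, hm'⟩ : ∃ m, s.var 2 = m := ⟨_, rfl⟩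
    rw [hk'] at hk hck hc
    rw [hc'] at hck hc
    rw [hm'] at hc hpos h2
    simp only [Expr.Fits, Expr.val, e0, hk']
    refine ⟨by omega, by omega, fun hlt => ?_⟩
    have hexec : Prog.exec (.seq (.store 10 (.var 21) (.var 22))
        (.seq (.assign 21 (.add (.var 21) (.const 1)))
          (.seq (.assign 22 (.add (.var 22) (.const 1)))
            (.ite (.var 22) (.var 2) .skip (.assign 22 (.const 0)))))) s' =
        ((s'.setArr 10 k c).setVar 21 (k + 1)).setVar 22 (if c + 1 < m then c + 1 else 0) := by
      by_cases hcm : c + 1 < m <;>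
      simp [Prog.exec, Expr.val, State.setVar, State.setArr, hk', hc', e2, hm', hcm]
    rw [hexec]
    refine ⟨?_, ⟨?_, ?_, fun hn => ⟨?_, fun j hj => ?_⟩⟩, ?_⟩
    · simp [Prog.Safe, Prog.exec, Expr.Fits, Expr.val, State.setVar, State.setArr, hk', hc', e2,
        hm']
      omega
    · simp [State.setVar]
      omega
    · simp [State.setVar]
      split_ifs <;> omega
    · obtain ⟨hc1, -⟩ := hc hn
      have hmp := hpos hn
      have hcm : c < m := hc1 ▸ Nat.mod_lt _ hmp
      simp [State.setVar, hm']
      rw [Nat.add_mod, ← hc1]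
      split_ifs with h
      · rw [Nat.mod_eq_of_lt (show 1 < m by omega), Nat.mod_eq_of_lt h]
      · obtain rfl : m = c + 1 := by omega
        rw [← Nat.add_mod_mod, Nat.mod_mod, Nat.add_mod_mod, Nat.mod_self]
    · obtain ⟨hc1, hc2⟩ := hc hn
      simp [State.setVar, State.setArr, Function.update_apply, hm'] at hj ⊢
      by_cases hjk : j = k
      · simp [hjk, hc1]
      · rw [if_neg hjk, hc2 j (by omega)]
    · simp [State.setVar]
      omega
  · calc _ ≤ (2 * n + 2) * 50 := Nat.mul_le_mul (by omega) (by decide)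
      _ ≤ _ := by omega
  · rintro s' hf ⟨hk, hck, hc⟩ hlt hn k hk2
    have e0 := (hf.1 0 (by decide)).trans h0
    simp only [Expr.val] at hlt
    exact (hc hn).2 k (by omega)

/-- Write the colors of the vertices. -/
def outputProg : Prog :=
  .while (.var 23) (.var 0)
    (.seq (.store 2 (.var 23) (.get 10 (.get 7 (.get 5 (.var 23)))))
      (.assign 23 (.add (.var 23) (.const 1))))

theorem outputProg_reaches (hW : 8 * (n + C) + 8 ≤ W) (h0 : s.var 0 = n) (h23 : s.var 23 = 0)
    (h5 : ∀ v < n, s.arr 5 v ≤ n) (h7 : ∀ v < n, s.arr 7 (s.arr 5 v) ≤ 2 * n)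
    (h10 : ∀ v < n, s.arr 10 (s.arr 7 (s.arr 5 v)) ≤ 2 * n) :
    outputProg.Reaches W s (100 * (n + 1)) fun s' =>
      ∀ v < n, s'.arr 2 v = s.arr 10 (s.arr 7 (s.arr 5 v)) := by
  refine Prog.reaches_while (fun s' => s'.var 23 ≤ n ∧
    ∀ v < s'.var 23, s'.arr 2 v = s.arr 10 (s.arr 7 (s.arr 5 v)))
    (fun s' => n - s'.var 23) ?_ ?_ ?_ ?_
  · exact ⟨by omega, fun v hv => by omega⟩
  · rintro s' hf ⟨hi, ha⟩
    have e0 := (hf.1 0 (by decide)).trans h0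
    have e5 := hf.2 5 (by decide)
    have e7 := hf.2 7 (by decide)
    have e10 := hf.2 10 (by decide)
    obtain ⟨i, hi'⟩ : ∃ i, s'.var 23 = i := ⟨_, rfl⟩
    rw [hi'] at hi ha
    simp only [Expr.Fits, Expr.val, e0, hi']
    refine ⟨by omega, by omega, fun hlt => ?_⟩
    have k5 := h5 i hlt
    have k7 := h7 i hlt
    have k10 := h10 i hlt
    refine ⟨?_, ⟨?_, fun v hv => ?_⟩, ?_⟩
    · simp [Prog.Safe, Prog.exec, Expr.Fits, Expr.val, State.setArr, hi', e5, e7, e10]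
      omega
    · simp [Prog.exec, Expr.val, State.setVar, State.setArr, hi']
      omega
    · simp [Prog.exec, Expr.val, State.setVar, State.setArr, hi', e5, e7, e10,
        Function.update_apply] at hv ⊢
      by_cases hvi : v = i
      · simp [hvi]
      · rw [if_neg hvi, ha v (by omega)]
    · simp [Prog.exec, Expr.val, State.setVar, State.setArr, hi']
      omega
  · calc _ ≤ (n + 1) * 100 := Nat.mul_le_mul (by omega) (by decide)
      _ ≤ _ := by omega
  · rintro s' hf ⟨hi, ha⟩ hlt v hv
    have e0 := (hf.1 0 (by decide)).trans h0
    simp only [Expr.val] at hlt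
    exact ha v (by omega)

end RAM

/-! ### Assembling the algorithm -/

namespace RAM

theorem Prog.Frame.var_zero {p : Prog} {s s' : State} {is : List ℕ} (hf : p.Frame s s')
    (h : ∀ i ∈ is, s.var i = 0) (hp : ∀ i ∈ is, i ∉ p.vars) : ∀ i ∈ is, s'.var i = 0 :=
  fun i hi => (hf.1 i (hp i hi)).trans (h i hi)

/-- Compute an optimal component coloring from a proper interval representation. -/
def coloringProg : Prog :=
  .seq countProg (.seq prefixProg (.seq rankProg (.seq quotientProg (.seq propagationProg
    (.seq fallbackProg (.seq remainderProg outputProg))))))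

/-- Span `q - 1` is tried first, for `q` the rounded-up quotient in variable `2`, and span `q` is
used if that fails. Optimality comes from the window bound in the first case and from the failure in
the second. -/
theorem coloringProg_reaches {n C M W : ℕ} {G : SimpleGraph (Fin n)} {l r : Fin n → ℕ}
    (hC : 0 < C) (hG : IsProperIntervalRep G l r) (hr : ∀ v, r v ≤ M)
    (hW : 8 * (n + C) + 8 ≤ W) (hM : M + 8 ≤ W) :
    coloringProg.Reaches W (inputState n C l r) (1700 * (n + 1) + 100 * (M + 2)) fun s =>
      ∃ B d, IsBlocking n C d (s.arr 6) B ∧ IsArrangement G n (stableRank l) (s.arr 6) ∧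
        (0 < n → s.var 2 = d + 1) ∧ (n = 0 → s.var 2 = 0) ∧
        (∀ d' B', IsBlocking n C d' (s.arr 6) B' → 0 < n → d ≤ d') ∧
        ∀ v : Fin n, s.arr 2 v = B (stableRank l v) % (d + 1) := by
  have hl : ∀ v, l v ≤ M := fun v => (hG.le v).trans (hr v)
  set s := inputState n C l r with hs
  have v0 : s.var 0 = n := rfl
  have v1 : s.var 1 = C := rfl
  have z0 : ∀ i ∈ [2, 3, 4, 5, 6, 8, 10, 12, 14, 15, 16, 20, 21, 22, 23], s.var i = 0 := by
    simp [hs, inputState]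
  have a0 : ∀ v : Fin n, s.arr 0 v = l v := fun v => by simp [hs, inputState]
  have a1 : ∀ v : Fin n, s.arr 1 v = r v := fun v => by simp [hs, inputState]
  have az : ∀ a ∈ [3, 4, 7, 8], ∀ j, s.arr a j = 0 := by
    simp [hs, inputState]
  refine Prog.Reaches.mono_time (T := 100 * (n + 1) + (100 * (M + 2) + (200 * (n + 1) +
    (100 * (n + 1) + (1000 * (n + 1) + (100 * (n + 1) + (100 * (n + 1) + 100 * (n + 1))))))))
    ?_ (by omega)
  refine (countProg_reaches (l := l) (r := r) hW (fun v => (hl v).trans (by omega))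
    (fun v => (hr v).trans (by omega)) v0 (z0 3 (by decide)) a0 a1
    (fun a ha => az a (by revert a; decide))).seq fun s₁ f₁ q₁ => ?_
  have z₁ := f₁.var_zero (is := [2, 4, 5, 6, 8, 10, 12, 14, 15, 16, 20, 21, 22, 23])
    (fun i hi => z0 i (by revert i; decide)) (by decide)
  have n₁ := (f₁.1 0 (by decide)).trans v0
  have c₁ := (f₁.1 1 (by decide)).trans v1
  refine (prefixProg_reaches hW hM hl n₁ (fun i hi => z₁ i (by revert i; decide))
    (fun x => (q₁ x).1) (fun x => (q₁ x).2)).seq fun s₂ f₂ q₂ => ?_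
  have z₂ := f₂.var_zero (is := [2, 8, 10, 12, 14, 15, 16, 20, 21, 22, 23])
    (fun i hi => z₁ i (by revert i; decide)) (by decide)
  have n₂ := (f₂.1 0 (by decide)).trans n₁
  have c₂ := (f₂.1 1 (by decide)).trans c₁
  have hal : ∀ v : Fin n, s₂.arr 0 v = l v := fun v => by
    rw [f₂.2 0 (by decide), f₁.2 0 (by decide), a0]
  refine (rankProg_reaches (l := l) (r := r) hW (fun v => (hl v).trans (by omega)) n₂
    (fun i hi => z₂ i (by revert i; decide)) hal (fun v => (q₂ v).1)
    (fun v => (q₂ v).2)).seq fun s₃ f₃ q₃ => ?_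
  obtain ⟨rank₃, left₃, window₃, least₃⟩ := q₃
  have z₃ := f₃.var_zero (is := [2, 12, 14, 15, 16, 20, 21, 22, 23])
    (fun i hi => z₂ i (by revert i; decide)) (by decide)
  have n₃ := (f₃.1 0 (by decide)).trans n₂
  have c₃ := (f₃.1 1 (by decide)).trans c₂
  have arr₃ : IsArrangement G n (stableRank l) (s₃.arr 6) := hG.isArrangement left₃
  have win₃ : s₃.var 10 ≤ n := least₃ n fun i hi => by omega
  refine (quotientProg_reaches hW hC c₃ (fun i hi => z₃ i (by revert i; decide)) win₃).seq
    fun s₄ f₄ q₄ => ?_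
  obtain ⟨le₄, least₄, n2₄, d₄⟩ := q₄
  have z₄ := f₄.var_zero (is := [14, 15, 16, 20, 21, 22, 23])
    (fun i hi => z₃ i (by revert i; decide)) (by decide)
  have n₄ := (f₄.1 0 (by decide)).trans n₃
  have c₄ := (f₄.1 1 (by decide)).trans c₃
  have L₄ := f₄.2 6 (by decide)
  have az₄ : ∀ a ∈ [7, 8], ∀ j, s₄.arr a j = 0 := fun a ha j => by
    rw [f₄.2 a (by revert a; decide), f₃.2 a (by revert a; decide),
      f₂.2 a (by revert a; decide), f₁.2 a (by revert a; decide)]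
    exact az a (by revert a; decide) j
  rw [← L₄] at arr₃ window₃ least₃
  refine (propagationProg_reaches hW hC (show s₄.var 2 - 1 ≤ n by omega) arr₃.le n₄ c₄ d₄
    (fun i hi => z₄ i (by revert i; decide)) az₄).seq fun s₅ f₅ q₅ => ?_
  obtain ⟨found₅, none₅, flag₅⟩ := q₅
  have z₅ := f₅.var_zero (is := [20, 21, 22, 23])
    (fun i hi => z₄ i (by revert i; decide)) (by decide)
  have n₅ := (f₅.1 0 (by decide)).trans n₄
  have c₅ := (f₅.1 1 (by decide)).trans c₄
  have l₅ := f₅.1 2 (by decide)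
  refine (fallbackProg_reaches hW hC n₅ c₅ (by omega) flag₅ (z₅ 20 (by decide))).seq
    fun s₆ f₆ q₆ => ?_
  obtain ⟨keep₆, new₆⟩ := q₆
  have z₆ := f₆.var_zero (is := [21, 22, 23]) (fun i hi => z₅ i (by revert i; decide)) (by decide)
  have n₆ := (f₆.1 0 (by decide)).trans n₅
  have lower : ∀ d' B', IsBlocking n C d' (s₄.arr 6) B' → s₄.var 2 ≤ d' + 1 := fun d' B' hB' =>
    least₄ _ (least₃ _ fun i hi => hB'.window_le hi)
  have pos₄ : 0 < n → 0 < s₄.var 2 := fun hn => by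
    by_contra! h0
    have h1 := window₃ 0 hn
    have h2 := arr₃.le 0 hn
    rw [Nat.le_zero.1 h0, Nat.zero_mul] at le₄
    omega
  have zero₄ : n = 0 → s₄.var 2 = 0 := fun hn => by
    have h1 := least₃ 0 fun i hi => by omega
    have h2 := least₄ 0 (by omega)
    omega
  have main : ∃ B d, IsBlocking n C d (s₄.arr 6) B ∧ (0 < n → s₆.var 2 = d + 1) ∧
      (n = 0 → s₆.var 2 = 0) ∧
      (∀ d' B', IsBlocking n C d' (s₄.arr 6) B' → 0 < n → d ≤ d') ∧
      (∀ i < n, s₆.arr 7 i = B i ∧ B i ≤ 2 * n) ∧ s₆.var 2 ≤ n + 1 := by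
    by_cases hflag : s₅.var 16 = 0
    · obtain ⟨hB, hBn⟩ := found₅ hflag
      obtain ⟨e2, e7⟩ := keep₆ hflag
      refine ⟨s₅.arr 7, s₄.var 2 - 1, hB, fun hn => ?_, fun hn => ?_, fun d' B' hB' _ => ?_,
        fun i hi => ⟨by rw [e7], hBn i hi⟩, by omega⟩
      · have := pos₄ hn
        omega
      · have := zero₄ hn
        omega
      · have := lower d' B' hB'
        omega
    · obtain ⟨e2, e7⟩ := new₆ hflag
      have hno := none₅ hflag
      have hB : IsBlocking n C (s₄.var 2) (s₄.arr 6) (fun i => i / C) :=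
        IsBlocking.of_div hC fun i hi => (window₃ i hi).trans le₄
      refine ⟨_, s₄.var 2, hB, fun hn => by omega, fun hn => ?_, fun d' B' hB' hn => ?_,
        fun i hi => ⟨e7 i hi, (Nat.div_le_self _ _).trans (by omega)⟩, by omega⟩
      · subst hn
        -- With no positions every map is a blocking, so the search cannot have failed.
        exact absurd ⟨fun i hi => by omega, fun i hi => by omega, fun i hi => by omega⟩
          (hno fun _ => 0)
      · have h1 := lower d' B' hB'
        by_contra! hlt
        -- The window bound leaves `q - 1` as the only smaller span, and it has just been refuted.
        obtain rfl : d' = s₄.var 2 - 1 := by omega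
        exact hno B' hB'
  obtain ⟨B, d, hB, hlam, hlam0, hmin, h7, hlamn⟩ := main
  refine (remainderProg_reaches hW n₆ hlamn (fun hn => by have := hlam hn; omega)
    (fun i hi => z₆ i (by revert i; decide))).seq fun s₇ f₇ q₇ => ?_
  have n₇ := (f₇.1 0 (by decide)).trans n₆
  have z₇ := f₇.var_zero (is := [23]) (fun i hi => z₆ i (by revert i; decide)) (by decide)
  have e7 : s₇.arr 7 = s₆.arr 7 := f₇.2 7 (by decide)
  have e5 : ∀ v : Fin n, s₇.arr 5 v = stableRank l v := fun v => by
    rw [f₇.2 5 (by decide), f₆.2 5 (by decide), f₅.2 5 (by decide), f₄.2 5 (by decide), rank₃]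
  have e6 : s₇.arr 6 = s₄.arr 6 := by
    rw [f₇.2 6 (by decide), f₆.2 6 (by decide), f₅.2 6 (by decide)]
  have val₇ : ∀ v (hv : v < n), s₇.arr 7 (s₇.arr 5 v) = B (stableRank l ⟨v, hv⟩) ∧
      B (stableRank l ⟨v, hv⟩) ≤ 2 * n := fun v hv => by
    rw [e7, e5 ⟨v, hv⟩]
    exact h7 _ (stableRank_lt_card l _)
  have col₇ : ∀ v (hv : v < n), s₇.arr 10 (s₇.arr 7 (s₇.arr 5 v)) =
      B (stableRank l ⟨v, hv⟩) % (d + 1) := fun v hv => by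
    rw [(val₇ v hv).1, q₇ (by omega) _ (val₇ v hv).2, hlam (by omega)]
  obtain ⟨t, s₈, run₈, t₈, f₈, q₈⟩ := outputProg_reaches hW n₇ (z₇ 23 (by decide))
    (fun v hv => (e5 ⟨v, hv⟩).trans_le (stableRank_lt_card l _).le)
    (fun v hv => (val₇ v hv).1.trans_le (val₇ v hv).2)
    (fun v hv => (col₇ v hv).trans_le ((Nat.mod_le _ _).trans (val₇ v hv).2))
  have e6' : s₈.arr 6 = s₄.arr 6 := (f₈.2 6 (by decide)).trans e6
  have e2 : s₈.var 2 = s₆.var 2 := (f₈.1 2 (by decide)).trans (f₇.1 2 (by decide))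
  refine ⟨t, s₈, run₈, t₈, f₈, B, d, ?_⟩
  rw [e6', e2]
  exact ⟨hB, arr₃, hlam, hlam0, hmin, fun v => (q₈ v v.2).trans (col₇ v v.2)⟩

end RAM

theorem theorem1 :
    ∃ p : RAM.Prog, ∀ K : ℕ, ∃ c : ℕ,
      ∀ (n C : ℕ) (G : SimpleGraph (Fin n)) (l r : Fin n → ℕ), 0 < C →
        IsProperIntervalRep G l r → (∀ v, r v ≤ K * n) →
          ∃ (t : ℕ) (s : RAM.State),
            RAM.Runs (c * (n + C)) p (inputState n C l r) t s ∧ t ≤ c * (n + 1) ∧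
              ∃ (lam : ℕ) (f : Fin n → Fin lam),
                IsOptimalComponentColoring G lam C f ∧ IsOutput s lam f := by
  -- The term `100 * K` pays for the scan over endpoint values up to `K * n`; `2000` pays for the
  -- rest, and since `C` is positive it also covers the additive constants in the word bound.
  refine ⟨RAM.coloringProg, fun K => ⟨100 * K + 2000, fun n C G l r hC hG hr => ?_⟩⟩
  have hW : (100 * K + 2000) * (n + C) = 100 * (K * n) + 100 * (K * C) + 2000 * (n + C) := by ring
  have hT : (100 * K + 2000) * (n + 1) = 100 * (K * n) + 100 * K + 2000 * (n + 1) := by ring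
  obtain ⟨t, s, hrun, ht, -, B, d, hB, hA, hlam, hlam0, hmin, hcol⟩ :=
    RAM.coloringProg_reaches (W := (100 * K + 2000) * (n + C)) hC hG hr (by omega) (by omega)
  refine ⟨t, s, hrun, by omega, ?_⟩
  rcases Nat.eq_zero_or_pos n with rfl | hn
  · exact ⟨0, Fin.elim0, ⟨fun i => i.elim0, fun _ _ _ => Nat.zero_le _⟩, hlam0 rfl,
      fun v => v.elim0⟩
  · refine ⟨d + 1, fun v => ⟨B (stableRank l v) % (d + 1), Nat.mod_lt _ (Nat.succ_pos d)⟩,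
      ⟨hB.isComponentColoring hA rfl _ fun _ => rfl, fun mu g hg => ?_⟩, hlam hn, hcol⟩
    -- The color of a vertex shows that at least one color is available, so the palette has the form
    -- `m + 1` that blockings require.
    obtain ⟨mu, rfl⟩ : ∃ m, mu = m + 1 := ⟨mu - 1, by have := (g ⟨0, hn⟩).2; omega⟩
    obtain ⟨B', hB'⟩ := hg.exists_isBlocking hC hA
    exact Nat.succ_le_succ (hmin mu B' hB' hn)
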